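/- **Model.** A helper sits at the center of the unit square and serves $n$ user terminals placed independently and uniformly at random on the square. With transmission range $R=R(n)=\Theta(\sqrt{\log n/n})$, the square is divided into $K\times K$ square-lets, $K=\lfloor 1/(C_1R)\rfloor$, where $C_1>0$ is constant and $C_1R\ge\sqrt{\log n/n}$ for large $n$. There are $m=C_3n^{\alpha}$ contents and each terminal has a cache for $M=C_4n^{\beta}$ encoded files ($C_3,C_4>0$, $\beta\ge 0$, both numbers rounded to integers, $M\ge1$ for large $n$). Requests are Zipf distributed: $P[r=i]=i^{-s}/\sum_{j=1}^m j^{-s}$, $1\le i\le m$. *Decentralized coded caching* over the contents $1,\dots,h$: each of the $M$ encoded files of each terminal is the $\mathrm{GF}(2)$-sum of a random subset of $\{1,\dots,h\}$ that contains each content with probability $1/2$, all choices being independent. A request is routed towards the helper along the square-lets crossed by the straight line between the terminal and the helper, one terminal per square-let acting as relay. The hop count $x$ of a request for $r\le h$ is the smallest $k$ such that content $r$ can be decoded (lies in the $\mathrm{GF}(2)$-span) from the encoded files of the requesting terminal and of the relays at most $k$ horizontal or vertical square-let moves away; if this does not happen before the helper is reached, or if $r>h$, then $x$ is the number of hops to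 the helper. For given positions of the terminals, $\mathbb E[x]$ is the average over the terminals, the request and the caches. The per-node capacity $\lambda_{\rm coded}(h)$ is the largest rate $\lambda$ with $n\lambda\,\mathbb E[x]\le W/(C_2C_1R)^2$, the right-hand side being the number of bits that the network delivers per unit of time ($W>0$ is the constant bandwidth, $C_2=(2+\Delta)/C_1$ the separation in square-lets of simultaneous transmitters, $\Delta>0$ the guard zone factor of the Protocol Model; congestion near the helper is not considered). **Statement.** Let $s>1$, $\alpha>\frac1{2(s-1)}$ and $0\le\beta\le\frac1s(\alpha+\frac12)$. Put $\rho_n=n^{\beta-\frac1s(\alpha+\frac12)}/\log n$. "With high probability" means with probability tending to one, as $n\to\infty$, over the positions of the terminals. 1. There are $h=h(n)$ with $h=\Theta(n^{\frac1s(\alpha+\frac12)})$ and $M<h$ for large $n$. For every such $h$: for all large $n$, $h\le m$ and $P[r\le h]\ge 1-\frac1{\sqrt n}$; there is $c>0$ such that with high probability all square-lets are occupied and $\lambda_{\rm coded}(h)\ge c\,\rho_n$; and if moreover $\beta>\frac1s(\alpha+\frac12)-\frac12$, then there are $c,c'>0$ such that with high probability all square-lets are occupied and $c\,\rho_n\le\lambda_{\rm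 coded}(h)\le c'\rho_n$, that is, $\lambda_{\rm coded}(h)=\Theta\!\left(n^{\beta-\frac1s(\alpha+\frac12)}\frac1{\log n}\right)$. 2. If $h$ is instead the smallest integer with $P[r\le h]\ge1-\frac1{\sqrt n}$, then the same rate is still achievable: there is $c>0$ such that with high probability all square-lets are occupied and $\lambda_{\rm coded}(h)\ge c\,\rho_n$. -/

import Mathlib

open Filter Topology MeasureTheory Asymptotics
open scoped BigOperators

namespace CodedCaching

/-! ### Content popularity -/

/-- Zipf popularity with parameter `s` on the contents `1, …, m`:
`P[r = i] = i^{-s} / ∑_{j=1}^m j^{-s}`. -/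
noncomputable def zipf (s : ℝ) (m i : ℕ) : ℝ :=
  (i : ℝ) ^ (-s) / ∑ j ∈ Finset.Icc 1 m, (j : ℝ) ^ (-s)

/-- The probability that a Zipf request falls on one of the contents `1, …, h` (of the `m`). -/
noncomputable def popularMass (s : ℝ) (m h : ℕ) : ℝ :=
  ∑ i ∈ Finset.Icc 1 (min h m), zipf s m i

/-- `h_ε`: the smallest `h` such that the contents `1, …, h` are requested with probability
at least `1 - ε`. -/
noncomputable def popularCount (s : ℝ) (m : ℕ) (ε : ℝ) : ℕ :=
  sInf {h : ℕ | 1 - ε ≤ popularMass s m h}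

/-! ### Deployment, square-lets and routes -/

/-- `n` user terminals, independently and uniformly distributed on the unit square. -/
noncomputable def deployment (n : ℕ) : Measure (Fin n → ℝ × ℝ) :=
  Measure.pi fun _ => (volume : Measure (ℝ × ℝ)).restrict (Set.Icc 0 1 ×ˢ Set.Icc 0 1)

/-- The helper is at the center of the unit square. -/
noncomputable def helper : ℝ × ℝ := (1 / 2, 1 / 2)

/-- Number of square-lets along one side of the unit square, when square-lets have side `C₁ * R`
(rounded up so that an integer number of them tiles the square). -/
noncomputable def gridSize (C₁ R : ℝ) : ℕ := ⌊1 / (C₁ * R)⌋₊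

/-- The square-let (column, row) that contains a point, in the `K × K` grid. -/
noncomputable def squarelet (K : ℕ) (y : ℝ × ℝ) : ℤ × ℤ :=
  (⌊(K : ℝ) * y.1⌋, ⌊(K : ℝ) * y.2⌋)

/-- Number of horizontal and vertical moves between two square-lets. -/
def moves (a b : ℤ × ℤ) : ℕ := (a.1 - b.1).natAbs + (a.2 - b.2).natAbs

/-- The route of a terminal located at `y`: the square-lets crossed by the straight line between
the terminal and the helper. -/
noncomputable def route (K : ℕ) (y : ℝ × ℝ) : Set (ℤ × ℤ) :=
  squarelet K '' segment ℝ y helper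

/-- Number of hops between a terminal at `y` and the helper (at least one). -/
noncomputable def hopsToHelper (K : ℕ) (y : ℝ × ℝ) : ℕ :=
  max 1 (moves (squarelet K y) (squarelet K helper))

/-- Every square-let contains a terminal. -/
def AllOccupied {n : ℕ} (K : ℕ) (Y : Fin n → ℝ × ℝ) : Prop :=
  ∀ a b : ℤ, 0 ≤ a → a < K → 0 ≤ b → b < K → ∃ j, squarelet K (Y j) = (a, b)

/-- Every (nonempty) square-let has one relay: its terminal of lowest index. -/
def IsRelay {n : ℕ} (K : ℕ) (Y : Fin n → ℝ × ℝ) (j : Fin n) : Prop :=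
  ∀ j', squarelet K (Y j') = squarelet K (Y j) → j ≤ j'

/-- The terminals that serve terminal `i` within `k` hops: itself (no hop), and the relays of
the square-lets of its route that are between `1` and `k` moves away. -/
def servers {n : ℕ} (K : ℕ) (Y : Fin n → ℝ × ℝ) (i : Fin n) (k : ℕ) : Set (Fin n) :=
  {j | j = i ∨ (IsRelay K Y j ∧ squarelet K (Y j) ∈ route K (Y i) ∧
    1 ≤ moves (squarelet K (Y i)) (squarelet K (Y j)) ∧
    moves (squarelet K (Y i)) (squarelet K (Y j)) ≤ k)}

/-! ### Coded caching and reconstruction -/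

/-- Contents of all the caches: each of the `n` terminals holds `M` encoded files, and an encoded
file is the sum over GF(2) of a subset of the popular contents `1, …, h`, given by its indicator
vector (coordinate `a` stands for content `a + 1`). -/
abbrev Caches (n M h : ℕ) : Type := Fin n → Fin M → Fin h → ZMod 2

/-- The coding vector of the uncoded content `r`, for `1 ≤ r ≤ h`. -/
def contentVec (h r : ℕ) : Fin h → ZMod 2 := fun a => if (a : ℕ) + 1 = r then 1 else 0

/-- Terminal `i` can reconstruct the popular content `r` from the encoded files found within
`k` hops. -/
def Decodable {n M h : ℕ} (K : ℕ) (Y : Fin n → ℝ × ℝ) (c : Caches n M h) (i : Fin n)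
    (r k : ℕ) : Prop :=
  contentVec h r ∈ Submodule.span (ZMod 2) {v | ∃ j ∈ servers K Y i k, ∃ a : Fin M, v = c j a}

open Classical in
/-- Number of hops traveled for a request of content `r` by terminal `i`. A popular content is
obtained from the encoded files on the route as soon as they suffice, and from the helper if they
never do; any other content always comes from the helper. -/
noncomputable def hops {n M h : ℕ} (K : ℕ) (Y : Fin n → ℝ × ℝ) (c : Caches n M h) (i : Fin n)
    (r : ℕ) : ℕ :=
  if r ≤ h then sInf {k : ℕ | Decodable K Y c i r k ∨ k = hopsToHelper K (Y i)}
  else hopsToHelper K (Y i)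

/-- `E[x]` for terminals located at `Y`: the average over the `n` terminals, over a Zipf request
on the contents `1, …, m`, and over independent random caches (every popular content enters every
encoded file with probability `1/2`, independently, i.e. all `Caches n M h` are equally
likely). -/
noncomputable def avgHops {n : ℕ} (s : ℝ) (m M h K : ℕ) (Y : Fin n → ℝ × ℝ) : ℝ :=
  Finset.expect Finset.univ fun i : Fin n =>
    ∑ r ∈ Finset.Icc 1 m, zipf s m r *
      Finset.expect Finset.univ fun c : Caches n M h => (hops K Y c i r : ℝ)

/-! ### Per-node capacity -/

/-- Number of bits that the network can deliver per unit of time: bandwidth `W` times the number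
`1 / (C₂ C₁ R)²` of square-lets that transmit simultaneously, where `R` is the transmission range,
`C₁ R` the side of the square-lets, and `C₂ = (2 + Δ) / C₁` the separation (in square-lets) of
simultaneous transmitters under the Protocol Model with guard zone factor `Δ`. -/
noncomputable def deliverable (W Δ C₁ R : ℝ) : ℝ :=
  W / (((2 + Δ) / C₁) * C₁ * R) ^ 2

/-- The per-node capacity of decentralized coded caching over the contents `1, …, h`, for terminals
located at `Y`: the largest rate `l` for which the `n * l * E[x]` bits to be delivered per unit of
time do not exceed what the network is capable of delivering. -/
noncomputable def capacity {n : ℕ} (W Δ C₁ R s : ℝ) (m M h : ℕ) (Y : Fin n → ℝ × ℝ) : ℝ :=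
  sSup {l : ℝ | n * l * avgHops s m M h (gridSize C₁ R) Y ≤ deliverable W Δ C₁ R}

/-- The events `E n` on the deployment of `n` terminals hold with probability tending to one. -/
def WHP (E : ∀ n : ℕ, Set (Fin n → ℝ × ℝ)) : Prop :=
  Tendsto (fun n => deployment n (E n)ᶜ) atTop (𝓝 0)

end CodedCaching

namespace CodedCaching

/-! ### Random linear combinations over GF(2) -/

theorem contentVec_ne_zero {h r : ℕ} (h1 : 1 ≤ r) (hr : r ≤ h) : contentVec h r ≠ 0 := by
  intro h0
  have := congrFun h0 ⟨r - 1, by omega⟩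
  simp [contentVec, show r - 1 + 1 = r by omega] at this

open Classical in
/-- Caches annihilated by a fixed linear form on the terminals of `S` are rare. -/
theorem card_annihilated_mul_le {n M h : ℕ} (S : Finset (Fin n))
    (f : (Fin h → ZMod 2) →ₗ[ZMod 2] ZMod 2) (v : Fin h → ZMod 2) (hv : f v ≠ 0) :
    (Finset.univ.filter fun c : Caches n M h => ∀ j ∈ S, ∀ a, f (c j a) = 0).card *
      2 ^ (S.card * M) ≤ Fintype.card (Caches n M h) := by
  have hfv : f v = 1 := by
    generalize f v = x at hv ⊢
    revert x; decide
  have hcard : Fintype.card (S → Fin M → ZMod 2) = 2 ^ (S.card * M) := by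
    simp [ZMod.card, pow_mul, mul_comm]
  rw [← hcard, ← Finset.card_univ (α := S → Fin M → ZMod 2), ← Finset.card_product,
    ← Finset.card_univ (α := Caches n M h)]
  refine Finset.card_le_card_of_injOn
    (fun p j a => p.1 j a + (if hj : j ∈ S then p.2 ⟨j, hj⟩ a else 0) • v)
    (fun _ _ => Finset.mem_coe.2 (Finset.mem_univ _)) ?_
  rintro ⟨c, u⟩ hc ⟨c', u'⟩ hc' heq
  simp only [Finset.coe_product, Set.mem_prod, Finset.mem_coe, Finset.mem_filter,
    Finset.mem_univ, true_and, and_true] at hc hc'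
  have key : u = u' := by
    funext j a
    have h1 := congrArg f (congrFun (congrFun heq j.1) a)
    simpa [hc j.1 j.2 a, hc' j.1 j.2 a, hfv] using h1
  subst key
  simp only [Prod.mk.injEq, and_true]
  funext j a
  exact add_right_cancel (congrFun (congrFun heq j) a)

open Classical in
/-- Caches for which a fixed nontrivial combination hits a given vector are rare. -/
theorem card_combination_mul_le {n M h : ℕ} (g : Fin n → Fin M → ZMod 2) (hg : g ≠ 0)
    (v : Fin h → ZMod 2) :
    (Finset.univ.filter fun c : Caches n M h => ∑ j, ∑ a, g j a • c j a = v).card * 2 ^ h ≤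
      Fintype.card (Caches n M h) := by
  obtain ⟨j₀, hj₀⟩ := Function.ne_iff.1 hg
  obtain ⟨a₀, ha₀⟩ := Function.ne_iff.1 hj₀
  have hg1 : g j₀ a₀ = 1 := by
    simp only [Pi.zero_apply] at ha₀
    generalize g j₀ a₀ = x at ha₀ ⊢
    revert x; decide
  have hcard : Fintype.card (Fin h → ZMod 2) = 2 ^ h := by simp [ZMod.card]
  have hsingle : ∀ u : Fin h → ZMod 2,
      ∑ j, ∑ a, g j a • (if j = j₀ then (if a = a₀ then u else 0) else 0) = u := by
    intro u
    rw [Finset.sum_eq_single j₀ (fun j _ hj => by simp [hj]) (by simp),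
      Finset.sum_eq_single a₀ (fun a _ ha => by simp [ha]) (by simp)]
    simp [hg1]
  rw [← hcard, ← Finset.card_univ (α := Fin h → ZMod 2), ← Finset.card_product,
    ← Finset.card_univ (α := Caches n M h)]
  refine Finset.card_le_card_of_injOn
    (fun p j a => p.1 j a + if j = j₀ then (if a = a₀ then p.2 else 0) else 0)
    (fun _ _ => Finset.mem_coe.2 (Finset.mem_univ _)) ?_
  rintro ⟨c, u⟩ hc ⟨c', u'⟩ hc' heq
  simp only [Finset.coe_product, Set.mem_prod, Finset.mem_coe, Finset.mem_filter,
    Finset.mem_univ, true_and, and_true] at hc hc'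
  have key : u = u' := by
    have h1 := congrArg (fun d : Caches n M h => ∑ j, ∑ a, g j a • d j a) heq
    simpa only [smul_add, Finset.sum_add_distrib, hc, hc', hsingle, add_right_inj] using h1
  subst key
  simp only [Prod.mk.injEq, and_true]
  funext j a
  exact add_right_cancel (congrFun (congrFun heq j) a)

open Classical in
theorem card_not_mem_span_mul_le {n M h : ℕ} (S : Finset (Fin n)) (v : Fin h → ZMod 2) :
    (Finset.univ.filter fun c : Caches n M h =>
      v ∉ Submodule.span (ZMod 2) {x | ∃ j ∈ S, ∃ a : Fin M, x = c j a}).card *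
        2 ^ (S.card * M) ≤ 2 ^ h * Fintype.card (Caches n M h) := by
  let lin : (Fin h → ZMod 2) → (Fin h → ZMod 2) →ₗ[ZMod 2] ZMod 2 := fun w =>
    Fintype.linearCombination (ZMod 2) w
  have hsub : (Finset.univ.filter fun c : Caches n M h =>
      v ∉ Submodule.span (ZMod 2) {x | ∃ j ∈ S, ∃ a : Fin M, x = c j a}) ⊆
      (Finset.univ.filter fun w => lin w v ≠ 0).biUnion fun w =>
        Finset.univ.filter fun c : Caches n M h => ∀ j ∈ S, ∀ a, lin w (c j a) = 0 := by
    intro c hc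
    obtain ⟨f, hf, hle⟩ := Submodule.exists_le_ker_of_notMem (Finset.mem_filter.1 hc).2
    have hlin : lin (fun i => f (Pi.single i 1)) = f := by
      ext i
      simp [lin, Fintype.linearCombination_apply_single]
    simp only [Finset.mem_biUnion, Finset.mem_filter, Finset.mem_univ, true_and]
    refine ⟨fun i => f (Pi.single i 1), by rwa [hlin], fun j hj a => ?_⟩
    rw [hlin]
    exact hle (Submodule.subset_span ⟨j, hj, a, rfl⟩)
  calc _ ≤ (∑ w ∈ Finset.univ.filter fun w => lin w v ≠ 0,
        (Finset.univ.filter fun c : Caches n M h => ∀ j ∈ S, ∀ a, lin w (c j a) = 0).card) *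
          2 ^ (S.card * M) :=
        Nat.mul_le_mul_right _ ((Finset.card_le_card hsub).trans Finset.card_biUnion_le)
    _ ≤ ∑ w ∈ Finset.univ.filter fun w => lin w v ≠ 0, Fintype.card (Caches n M h) := by
        rw [Finset.sum_mul]
        exact Finset.sum_le_sum fun w hw =>
          card_annihilated_mul_le S (lin w) v (Finset.mem_filter.1 hw).2
    _ ≤ 2 ^ h * Fintype.card (Caches n M h) := by
        rw [Finset.sum_const, smul_eq_mul]
        refine Nat.mul_le_mul_right _ ((Finset.card_filter_le _ _).trans ?_)
        simp [ZMod.card]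

open Classical in
theorem card_mem_span_mul_le {n M h : ℕ} (S : Finset (Fin n)) (v : Fin h → ZMod 2) (hv : v ≠ 0) :
    (Finset.univ.filter fun c : Caches n M h =>
      v ∈ Submodule.span (ZMod 2) {x | ∃ j ∈ S, ∃ a : Fin M, x = c j a}).card * 2 ^ h ≤
        2 ^ (S.card * M) * Fintype.card (Caches n M h) := by
  obtain ⟨ext0, hsum⟩ : ∃ ext0 : (S → Fin M → ZMod 2) → Fin n → Fin M → ZMod 2,
      ∀ (g : S → Fin M → ZMod 2) (c : Caches n M h),
        ∑ j, ∑ a, ext0 g j a • c j a = ∑ j : S, ∑ a, g j a • c j a := by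
    refine ⟨fun g j a => if hj : j ∈ S then g ⟨j, hj⟩ a else 0, fun g c => ?_⟩
    rw [← Finset.sum_subset (Finset.subset_univ S), ← Finset.sum_coe_sort S]
    · refine Finset.sum_congr rfl fun j _ => Finset.sum_congr rfl fun a _ => ?_
      simp
    · intro j _ hj
      simp [hj]
  have hsub : (Finset.univ.filter fun c : Caches n M h =>
      v ∈ Submodule.span (ZMod 2) {x | ∃ j ∈ S, ∃ a : Fin M, x = c j a}) ⊆
      (Finset.univ.filter fun g => ext0 g ≠ 0).biUnion fun g =>
        Finset.univ.filter fun c : Caches n M h => ∑ j, ∑ a, ext0 g j a • c j a = v := by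
    intro c hc
    have hc := (Finset.mem_filter.1 hc).2
    have hset : {x | ∃ j ∈ S, ∃ a : Fin M, x = c j a} =
        Set.range fun p : S × Fin M => c p.1 p.2 := by
      ext x
      simp [eq_comm]
    rw [hset, Submodule.mem_span_range_iff_exists_fun] at hc
    obtain ⟨g, hg⟩ := hc
    rw [Fintype.sum_prod_type] at hg
    have hg' : ∑ j, ∑ a, ext0 (fun j a => g (j, a)) j a • c j a = v :=
      (hsum _ c).trans hg
    simp only [Finset.mem_biUnion, Finset.mem_filter, Finset.mem_univ, true_and]
    refine ⟨fun j a => g (j, a), fun h0 => hv ?_, hg'⟩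
    rw [← hg', h0]
    simp
  calc _ ≤ (∑ g ∈ Finset.univ.filter fun g => ext0 g ≠ 0,
        (Finset.univ.filter fun c : Caches n M h =>
          ∑ j, ∑ a, ext0 g j a • c j a = v).card) * 2 ^ h :=
        Nat.mul_le_mul_right _ ((Finset.card_le_card hsub).trans Finset.card_biUnion_le)
    _ ≤ ∑ g ∈ Finset.univ.filter fun g => ext0 g ≠ 0, Fintype.card (Caches n M h) := by
        rw [Finset.sum_mul]
        exact Finset.sum_le_sum fun g hg =>
          card_combination_mul_le (ext0 g) (Finset.mem_filter.1 hg).2 v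
    _ ≤ 2 ^ (S.card * M) * Fintype.card (Caches n M h) := by
        rw [Finset.sum_const, smul_eq_mul]
        refine Nat.mul_le_mul_right _ ((Finset.card_filter_le _ _).trans ?_)
        simp [ZMod.card, pow_mul, mul_comm]

/-! ### Decoding probabilities -/

theorem expect_indicator {α : Type*} [Fintype α] (P : α → Prop) [DecidablePred P] :
    (Finset.expect Finset.univ fun c : α => if P c then (1 : ℝ) else 0) =
      ((Finset.univ.filter P).card : ℝ) / Fintype.card α := by
  rw [Finset.expect_eq_sum_div_card, Finset.sum_boole, Finset.card_univ]

open Classical in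
theorem expect_not_decodable_le {n M h : ℕ} (K : ℕ) (Y : Fin n → ℝ × ℝ) (i : Fin n) (r k : ℕ) :
    (Finset.expect Finset.univ fun c : Caches n M h =>
      if ¬ Decodable K Y c i r k then (1 : ℝ) else 0) ≤
        2 ^ h / 2 ^ ((servers K Y i k).ncard * M) := by
  rw [expect_indicator, div_le_div_iff₀ (by exact_mod_cast Fintype.card_pos) (by positivity)]
  have := card_not_mem_span_mul_le (M := M) (servers K Y i k).toFinset (contentVec h r)
  rw [← Set.ncard_eq_toFinset_card'] at this
  simp only [Set.mem_toFinset] at this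
  exact_mod_cast this

open Classical in
theorem expect_decodable_le {n M h : ℕ} (K : ℕ) (Y : Fin n → ℝ × ℝ) (i : Fin n) {r : ℕ} (k : ℕ)
    (h1 : 1 ≤ r) (hr : r ≤ h) :
    (Finset.expect Finset.univ fun c : Caches n M h =>
      if Decodable K Y c i r k then (1 : ℝ) else 0) ≤
        2 ^ ((servers K Y i k).ncard * M) / 2 ^ h := by
  rw [expect_indicator, div_le_div_iff₀ (by exact_mod_cast Fintype.card_pos) (by positivity)]
  have := card_mem_span_mul_le (M := M) (servers K Y i k).toFinset _ (contentVec_ne_zero h1 hr)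
  rw [← Set.ncard_eq_toFinset_card'] at this
  simp only [Set.mem_toFinset] at this
  exact_mod_cast this

/-! ### Square-lets on a route -/

theorem natAbs_floor_add_sub_le {b x : ℝ} {j : ℕ} (hx : |x| ≤ j) :
    (⌊b + x⌋ - ⌊b⌋).natAbs ≤ j := by
  obtain ⟨h1, h2⟩ := abs_le.1 hx
  have e1 : ⌊b + x⌋ ≤ ⌊b⌋ + j := by
    rw [← Int.floor_add_natCast]
    exact Int.floor_le_floor (by linarith)
  have e2 : ⌊b⌋ - j ≤ ⌊b + x⌋ := by
    rw [← Int.floor_sub_natCast]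
    exact Int.floor_le_floor (by linarith)
  omega

theorem exists_natAbs_floor_eq {a b da db : ℝ} (hd : |db| ≤ |da|) {j : ℕ} (hj : (j : ℝ) ≤ |da|) :
    ∃ t ∈ Set.Icc (0 : ℝ) 1, (⌊a + t * da⌋ - ⌊a⌋).natAbs = j ∧
      (⌊b + t * db⌋ - ⌊b⌋).natAbs ≤ j := by
  rcases (abs_nonneg da).eq_or_lt with h0 | hpos
  · refine ⟨0, by simp, ?_, by simp⟩
    rw [← h0] at hj
    have : j = 0 := by exact_mod_cast le_antisymm hj (Nat.cast_nonneg j)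
    simp [this]
  · have ht0 : 0 ≤ (j : ℝ) / |da| := by positivity
    refine ⟨j / |da|, ⟨ht0, (div_le_one hpos).2 hj⟩, ?_, natAbs_floor_add_sub_le ?_⟩
    · rcases abs_cases da with ⟨h1, -⟩ | ⟨h1, -⟩
      · rw [h1, div_mul_cancel₀ _ (by rw [← h1]; exact hpos.ne'), Int.floor_add_natCast]
        omega
      · have : (j : ℝ) / |da| * da = -j := by
          rw [h1, div_neg, neg_mul, div_mul_cancel₀ _ (by intro h; simp [h] at hpos)]
        rw [this, ← sub_eq_add_neg, Int.floor_sub_natCast]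
        omega
    · rw [abs_mul, abs_of_nonneg ht0, div_mul_eq_mul_div, div_le_iff₀ hpos]
      exact mul_le_mul_of_nonneg_left hd (Nat.cast_nonneg j)

theorem mem_route_iff {K : ℕ} {y : ℝ × ℝ} {q : ℤ × ℤ} : q ∈ route K y ↔
    ∃ t ∈ Set.Icc (0 : ℝ) 1, q = (⌊K * y.1 + t * (K * (1 / 2 - y.1))⌋,
      ⌊K * y.2 + t * (K * (1 / 2 - y.2))⌋) := by
  rw [route, segment_eq_image']
  constructor
  · rintro ⟨_, ⟨t, ht, rfl⟩, rfl⟩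
    refine ⟨t, ht, ?_⟩
    simp only [squarelet, helper, Prod.fst_add, Prod.snd_add, Prod.smul_fst, Prod.smul_snd,
      Prod.fst_sub, Prod.snd_sub, smul_eq_mul]
    congr 2 <;> ring
  · rintro ⟨t, ht, rfl⟩
    refine ⟨_, ⟨t, ht, rfl⟩, ?_⟩
    simp only [squarelet, helper, Prod.fst_add, Prod.snd_add, Prod.smul_fst, Prod.smul_snd,
      Prod.fst_sub, Prod.snd_sub, smul_eq_mul]
    congr 2 <;> ring

theorem floor_mem_grid {K : ℕ} (hK : 0 < K) {y t : ℝ} (hy : y ∈ Set.Ico (0 : ℝ) 1)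
    (ht : t ∈ Set.Icc (0 : ℝ) 1) :
    0 ≤ ⌊K * y + t * (K * (1 / 2 - y))⌋ ∧ ⌊K * y + t * (K * (1 / 2 - y))⌋ < K := by
  have hK' : (0 : ℝ) < K := by exact_mod_cast hK
  have e : (K : ℝ) * y + t * (K * (1 / 2 - y)) = K * ((1 - t) * y + t * (1 / 2)) := by ring
  have h0 : 0 ≤ (1 - t) * y + t * (1 / 2) := by
    have := mul_nonneg (sub_nonneg.2 ht.2) hy.1
    linarith [ht.1]
  have h1 : (1 - t) * y + t * (1 / 2) < 1 := by
    rcases ht.2.eq_or_lt with rfl | h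
    · norm_num
    · have := mul_lt_mul_of_pos_left hy.2 (sub_pos.2 h)
      linarith [ht.1]
  rw [e]
  constructor
  · exact Int.floor_nonneg.2 (by positivity)
  · rw [Int.floor_lt]
    push_cast
    nlinarith

theorem exists_isRelay {n K : ℕ} {Y : Fin n → ℝ × ℝ} {q : ℤ × ℤ}
    (h : ∃ j, squarelet K (Y j) = q) : ∃ j, IsRelay K Y j ∧ squarelet K (Y j) = q := by
  obtain ⟨j, hj, hmin⟩ := WellFounded.has_min (wellFounded_lt (α := Fin n))
    {j | squarelet K (Y j) = q} h
  exact ⟨j, fun j' hj' => not_lt.1 (hmin j' (hj'.trans hj)), hj⟩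

theorem hopsToHelper_le_of_abs_le {K : ℕ} {y : ℝ × ℝ} {D : ℝ}
    (h1 : |(K : ℝ) * (1 / 2 - y.1)| ≤ D) (h2 : |(K : ℝ) * (1 / 2 - y.2)| ≤ D) :
    hopsToHelper K y ≤ 2 * ⌊D⌋₊ + 2 := by
  have hD' : D ≤ (⌊D⌋₊ + 1 : ℕ) := by
    push_cast
    exact (Nat.lt_floor_add_one D).le
  have e1 := natAbs_floor_add_sub_le (b := K * y.1) (h1.trans hD')
  have e2 := natAbs_floor_add_sub_le (b := K * y.2) (h2.trans hD')
  have s1 : (K : ℝ) * y.1 + K * (1 / 2 - y.1) = K * (1 / 2) := by ring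
  have s2 : (K : ℝ) * y.2 + K * (1 / 2 - y.2) = K * (1 / 2) := by ring
  rw [s1] at e1
  rw [s2] at e2
  simp only [hopsToHelper, moves, squarelet, helper]
  omega

/-- With every square-let occupied, a terminal has many servers within `k` hops. -/
theorem le_ncard_servers {n K : ℕ} (hK : 0 < K) {Y : Fin n → ℝ × ℝ} (hocc : AllOccupied K Y)
    {i : Fin n} (hy : Y i ∈ Set.Ico (0 : ℝ) 1 ×ˢ Set.Ico (0 : ℝ) 1) {k : ℕ}
    (hk : k < hopsToHelper K (Y i)) : k / 2 + 1 ≤ (servers K Y i k).ncard := by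
  classical
  have main : ∀ {t : ℝ}, t ∈ Set.Icc (0 : ℝ) 1 → ∀ {u v j : ℕ},
      (⌊K * (Y i).1 + t * (K * (1 / 2 - (Y i).1))⌋ - ⌊K * (Y i).1⌋).natAbs = u →
      (⌊K * (Y i).2 + t * (K * (1 / 2 - (Y i).2))⌋ - ⌊K * (Y i).2⌋).natAbs = v →
      u ≤ j → v ≤ j → j ≤ k / 2 → 1 ≤ u + v →
      ∃ p ∈ servers K Y i k,
        ((squarelet K (Y p)).1 - (squarelet K (Y i)).1).natAbs = u ∧
        ((squarelet K (Y p)).2 - (squarelet K (Y i)).2).natAbs = v := by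
    intro t ht u v j hu hv huj hvj hjk huv
    have g1 := floor_mem_grid hK hy.1 ht
    have g2 := floor_mem_grid hK hy.2 ht
    obtain ⟨p, hp, hpq⟩ := exists_isRelay (hocc _ _ g1.1 g1.2 g2.1 g2.2)
    refine ⟨p, Or.inr ⟨hp, ?_, ?_, ?_⟩, ?_, ?_⟩
    · rw [hpq]
      exact mem_route_iff.2 ⟨t, ht, rfl⟩
    · rw [hpq]
      simp only [moves, squarelet]
      omega
    · rw [hpq]
      simp only [moves, squarelet]
      omega
    · rw [hpq]
      exact hu
    · rw [hpq]
      exact hv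
  have hself : i ∈ servers K Y i k := Or.inl rfl
  have surj : ∀ (proj : ℤ × ℤ → ℤ), (∀ j : ℕ, j ≤ k / 2 → ∃ p ∈ servers K Y i k,
      (proj (squarelet K (Y p)) - proj (squarelet K (Y i))).natAbs = j) →
      k / 2 + 1 ≤ (servers K Y i k).ncard := by
    intro proj hproj
    rw [Set.ncard_eq_toFinset_card', ← Finset.card_range (k / 2 + 1)]
    refine Finset.card_le_card_of_surjOn
      (fun p => (proj (squarelet K (Y p)) - proj (squarelet K (Y i))).natAbs) ?_
    intro j hj
    obtain ⟨p, hp, hpj⟩ := hproj j (by simpa [Nat.lt_succ_iff] using hj)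
    exact ⟨p, by simpa using hp, hpj⟩
  rcases le_total |(K : ℝ) * (1 / 2 - (Y i).2)| |(K : ℝ) * (1 / 2 - (Y i).1)| with hd | hd
  · have hL := hopsToHelper_le_of_abs_le le_rfl hd
    refine surj Prod.fst fun j hj => ?_
    rcases Nat.eq_zero_or_pos j with rfl | hj0
    · exact ⟨i, hself, by simp⟩
    have hj' : (j : ℝ) ≤ |(K : ℝ) * (1 / 2 - (Y i).1)| :=
      (Nat.le_floor_iff (abs_nonneg _)).1 (by omega)
    obtain ⟨t, ht, h1, h2⟩ := exists_natAbs_floor_eq (a := K * (Y i).1) (b := K * (Y i).2) hd hj'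
    obtain ⟨p, hp, hp1, -⟩ := main ht h1 rfl le_rfl h2 hj (by omega)
    exact ⟨p, hp, hp1⟩
  · have hL := hopsToHelper_le_of_abs_le hd le_rfl
    refine surj Prod.snd fun j hj => ?_
    rcases Nat.eq_zero_or_pos j with rfl | hj0
    · exact ⟨i, hself, by simp⟩
    have hj' : (j : ℝ) ≤ |(K : ℝ) * (1 / 2 - (Y i).2)| :=
      (Nat.le_floor_iff (abs_nonneg _)).1 (by omega)
    obtain ⟨t, ht, h1, h2⟩ := exists_natAbs_floor_eq (a := K * (Y i).2) (b := K * (Y i).1) hd hj'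
    obtain ⟨p, hp, -, hp1⟩ := main ht rfl h1 h2 le_rfl hj (by omega)
    exact ⟨p, hp, hp1⟩

theorem floor_sub_monotone (a d : ℝ) :
    (∀ t t', 0 ≤ t → t ≤ t' → 0 ≤ ⌊a + t * d⌋ - ⌊a⌋ ∧ ⌊a + t * d⌋ ≤ ⌊a + t' * d⌋) ∨
    (∀ t t', 0 ≤ t → t ≤ t' → ⌊a + t * d⌋ - ⌊a⌋ ≤ 0 ∧ ⌊a + t' * d⌋ ≤ ⌊a + t * d⌋) := by
  rcases le_total 0 d with hd | hd
  · refine Or.inl fun t t' ht htt' => ⟨sub_nonneg.2 (Int.floor_le_floor ?_), Int.floor_le_floor ?_⟩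
    · linarith [mul_nonneg ht hd]
    · linarith [mul_le_mul_of_nonneg_right htt' hd]
  · refine Or.inr fun t t' ht htt' => ⟨sub_nonpos.2 (Int.floor_le_floor ?_), Int.floor_le_floor ?_⟩
    · linarith [mul_nonpos_of_nonneg_of_nonpos ht hd]
    · linarith [mul_le_mul_of_nonpos_right htt' hd]

/-- Square-lets of a route are determined by their distance from its start. -/
theorem eq_of_moves_eq {K : ℕ} {y : ℝ × ℝ} {q q' : ℤ × ℤ} (hq : q ∈ route K y)
    (hq' : q' ∈ route K y) (h : moves (squarelet K y) q = moves (squarelet K y) q') : q = q' := by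
  obtain ⟨t, ht, rfl⟩ := mem_route_iff.1 hq
  obtain ⟨t', ht', rfl⟩ := mem_route_iff.1 hq'
  simp only [moves, squarelet] at h
  have m1 := floor_sub_monotone (K * y.1) (K * (1 / 2 - y.1))
  have m2 := floor_sub_monotone (K * y.2) (K * (1 / 2 - y.2))
  rw [Prod.mk.injEq]
  rcases le_total t t' with hle | hle
  · rcases m1 with m1 | m1 <;> rcases m2 with m2 | m2 <;>
    · have a1 := m1 t t' ht.1 hle
      have a2 := m2 t t' ht.1 hle
      have a3 := m1 t' t' ht'.1 le_rfl
      have a4 := m2 t' t' ht'.1 le_rfl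
      omega
  · rcases m1 with m1 | m1 <;> rcases m2 with m2 | m2 <;>
    · have a1 := m1 t' t ht'.1 hle
      have a2 := m2 t' t ht'.1 hle
      have a3 := m1 t t ht.1 le_rfl
      have a4 := m2 t t ht.1 le_rfl
      omega

theorem ncard_servers_le {n : ℕ} (K : ℕ) (Y : Fin n → ℝ × ℝ) (i : Fin n) (k : ℕ) :
    (servers K Y i k).ncard ≤ k + 1 := by
  classical
  rw [Set.ncard_eq_toFinset_card', ← Finset.card_range (k + 1)]
  refine Finset.card_le_card_of_injOn
    (fun j => moves (squarelet K (Y i)) (squarelet K (Y j))) ?_ ?_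
  · intro j hj
    have hj : j ∈ servers K Y i k := by simpa using hj
    rcases hj with rfl | hj
    · simp [moves]
    · simpa [Nat.lt_succ_iff] using hj.2.2.2
  · intro j hj j' hj' h
    have hj : j ∈ servers K Y i k := by simpa using hj
    have hj' : j' ∈ servers K Y i k := by simpa using hj'
    simp only at h
    have hz : moves (squarelet K (Y i)) (squarelet K (Y i)) = 0 := by simp [moves]
    rcases hj with rfl | hj <;> rcases hj' with rfl | hj'
    · rfl
    · omega
    · omega
    · have := eq_of_moves_eq hj.2.1 hj'.2.1 h
      exact le_antisymm (hj.1 j' this.symm) (hj'.1 j this)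

theorem servers_mono {n : ℕ} (K : ℕ) (Y : Fin n → ℝ × ℝ) (i : Fin n) : Monotone (servers K Y i) := by
  rintro k k' hk j (hj | hj)
  · exact Or.inl hj
  · exact Or.inr ⟨hj.1, hj.2.1, hj.2.2.1, hj.2.2.2.trans hk⟩

theorem one_le_hopsToHelper (K : ℕ) (y : ℝ × ℝ) : 1 ≤ hopsToHelper K y := le_max_left _ _

theorem hopsToHelper_le {K : ℕ} {y : ℝ × ℝ}
    (hy : y ∈ Set.Ico (0 : ℝ) 1 ×ˢ Set.Ico (0 : ℝ) 1) : hopsToHelper K y ≤ 2 * K + 2 := by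
  have hb : ∀ x ∈ Set.Ico (0 : ℝ) 1, |(K : ℝ) * (1 / 2 - x)| ≤ K := by
    intro x hx
    rw [abs_mul, Nat.abs_cast]
    refine mul_le_of_le_one_right (Nat.cast_nonneg K) (abs_le.2 ⟨?_, ?_⟩) <;> linarith [hx.1, hx.2]
  simpa using hopsToHelper_le_of_abs_le (hb _ hy.1) (hb _ hy.2)

theorem le_hopsToHelper (K : ℕ) (y : ℝ × ℝ) :
    (K : ℝ) * |y.1 - 1 / 2| - 1 ≤ hopsToHelper K y := by
  have h1 : ((⌊(K : ℝ) * y.1⌋ - ⌊(K : ℝ) * (1 / 2)⌋).natAbs : ℝ) ≤ hopsToHelper K y := by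
    have : (⌊(K : ℝ) * y.1⌋ - ⌊(K : ℝ) * (1 / 2)⌋).natAbs ≤ hopsToHelper K y := by
      simp only [hopsToHelper, moves, squarelet, helper]
      omega
    exact_mod_cast this
  refine le_trans ?_ h1
  rw [Nat.cast_natAbs, Int.cast_abs]
  push_cast
  have a1 := Int.floor_le ((K : ℝ) * y.1)
  have a2 := Int.lt_floor_add_one ((K : ℝ) * y.1)
  have a3 := Int.floor_le ((K : ℝ) * (1 / 2))
  have a4 := Int.lt_floor_add_one ((K : ℝ) * (1 / 2))
  have e : (K : ℝ) * |y.1 - 1 / 2| = |K * y.1 - K * (1 / 2)| := by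
    rw [← mul_sub, abs_mul, Nat.abs_cast]
  rw [e]
  set u : ℝ := (⌊(K : ℝ) * y.1⌋ : ℝ) - ⌊(K : ℝ) * (1 / 2)⌋ with hu
  rcases abs_cases ((K : ℝ) * y.1 - K * (1 / 2)) with ⟨h, -⟩ | ⟨h, -⟩
  · rw [h]
    linarith [le_abs_self u]
  · rw [h]
    linarith [neg_le_abs u]

/-! ### Expected number of hops -/

section Hops
variable {n M h : ℕ} {K : ℕ} {Y : Fin n → ℝ × ℝ} {c : Caches n M h} {i : Fin n} {r k : ℕ}

theorem Decodable.mono {k' : ℕ} (hk : k ≤ k') (hd : Decodable K Y c i r k) :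
    Decodable K Y c i r k' :=
  Submodule.span_mono (by
    rintro _ ⟨j, hj, a, rfl⟩
    exact ⟨j, servers_mono K Y i hk hj, a, rfl⟩) hd

theorem hops_le_hopsToHelper : hops K Y c i r ≤ hopsToHelper K (Y i) := by
  unfold hops
  split_ifs
  · exact Nat.sInf_le (Or.inr rfl)
  · exact le_rfl

open Classical in
theorem hops_le_sum (hr : r ≤ h) : (hops K Y c i r : ℝ) ≤
    ∑ k ∈ Finset.range (hopsToHelper K (Y i)), if ¬ Decodable K Y c i r k then (1 : ℝ) else 0 := by
  rw [Finset.sum_boole]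
  have : Finset.range (hops K Y c i r) ⊆
      (Finset.range (hopsToHelper K (Y i))).filter fun k => ¬ Decodable K Y c i r k := by
    intro k hk
    have hk := Finset.mem_range.1 hk
    refine Finset.mem_filter.2 ⟨Finset.mem_range.2 (hk.trans_le hops_le_hopsToHelper), fun hd => ?_⟩
    rw [hops, if_pos hr] at hk
    exact Nat.notMem_of_lt_sInf hk (Or.inl hd)
  have := Finset.card_le_card this
  rw [Finset.card_range] at this
  exact_mod_cast this

theorem le_hops_of_not_decodable (hd : ¬ Decodable K Y c i r k) :
    min (hopsToHelper K (Y i)) (k + 1) ≤ hops K Y c i r := by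
  unfold hops
  split_ifs with hr
  · have hmem := Nat.sInf_mem (s := {k : ℕ | Decodable K Y c i r k ∨ k = hopsToHelper K (Y i)})
      ⟨_, Or.inr rfl⟩
    rcases hmem with hx | hx
    · refine (min_le_right _ _).trans (Nat.succ_le_of_lt (lt_of_not_ge fun hle => hd ?_))
      exact Decodable.mono hle hx
    · rw [hx]
      exact min_le_left _ _
  · exact min_le_left _ _

theorem expect_hops_le (hK : 0 < K) (hocc : AllOccupied K Y)
    (hy : Y i ∈ Set.Ico (0 : ℝ) 1 ×ˢ Set.Ico (0 : ℝ) 1) {q : ℕ} (hM : 1 ≤ M) (hq : h ≤ q * M)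
    (hr : r ≤ h) :
    (Finset.expect Finset.univ fun c : Caches n M h => (hops K Y c i r : ℝ)) ≤ 2 * q + 4 := by
  classical
  set L := hopsToHelper K (Y i)
  let b : ℕ → ℝ := fun k => if k < 2 * q then 1 else (3 / 4) ^ (k - 2 * q)
  have hb0 : ∀ k, 0 ≤ b k := fun k => by
    simp only [b]
    split_ifs <;> positivity
  have hterm : ∀ k ∈ Finset.range L, (Finset.expect Finset.univ fun c : Caches n M h =>
      if ¬ Decodable K Y c i r k then (1 : ℝ) else 0) ≤ b k := by
    intro k hk
    simp only [b]
    split_ifs with hkq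
    · calc _ ≤ Finset.expect Finset.univ fun _ : Caches n M h => (1 : ℝ) :=
            Finset.expect_le_expect fun c _ => by split_ifs <;> norm_num
        _ = 1 := Fintype.expect_const 1
    · refine (expect_not_decodable_le K Y i r k).trans ?_
      have hS := le_ncard_servers hK hocc hy (Finset.mem_range.1 hk)
      set N := (servers K Y i k).ncard
      obtain ⟨l, rfl⟩ := Nat.exists_eq_add_of_le (not_lt.1 hkq)
      obtain ⟨u, hu⟩ := Nat.exists_eq_add_of_le (show q ≤ N by omega)
      have hul : l ≤ 2 * u := by omega
      have hNM : h + u ≤ N * M := by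
        rw [hu, add_mul]
        exact add_le_add hq (Nat.le_mul_of_pos_right u hM)
      rw [Nat.add_sub_cancel_left, div_le_iff₀ (by positivity)]
      have e1 : (2 : ℝ) ^ h * 2 ^ u ≤ 2 ^ (N * M) := by
        rw [← pow_add]
        exact pow_le_pow_right₀ (by norm_num) hNM
      have e2 : ((9 : ℝ) / 16) ^ u ≤ (3 / 4) ^ l := by
        rw [show (9 : ℝ) / 16 = (3 / 4) ^ 2 by norm_num, ← pow_mul]
        exact pow_le_pow_of_le_one (by norm_num) (by norm_num) hul
      have e3 : (1 : ℝ) ≤ (9 / 16) ^ u * 2 ^ u := by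
        rw [← mul_pow]
        exact one_le_pow₀ (by norm_num)
      calc (2 : ℝ) ^ h ≤ 2 ^ h * ((9 / 16) ^ u * 2 ^ u) := le_mul_of_one_le_right (by positivity) e3
        _ = (9 / 16) ^ u * (2 ^ h * 2 ^ u) := by ring
        _ ≤ (3 / 4) ^ l * 2 ^ (N * M) := by gcongr
  have hgeom : ∑ l ∈ Finset.range L, ((3 : ℝ) / 4) ^ l ≤ 4 := by
    rw [geom_sum_eq (by norm_num), div_le_iff_of_neg (by norm_num)]
    have : (0 : ℝ) ≤ (3 / 4) ^ L := by positivity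
    linarith
  calc _ ≤ Finset.expect Finset.univ fun c : Caches n M h => ∑ k ∈ Finset.range L,
        if ¬ Decodable K Y c i r k then (1 : ℝ) else 0 :=
        Finset.expect_le_expect fun c _ => hops_le_sum hr
    _ = ∑ k ∈ Finset.range L, Finset.expect Finset.univ fun c : Caches n M h =>
        if ¬ Decodable K Y c i r k then (1 : ℝ) else 0 := Finset.expect_sum_comm _ _ _
    _ ≤ ∑ k ∈ Finset.range L, b k := Finset.sum_le_sum hterm
    _ ≤ ∑ k ∈ Finset.range (2 * q + L), b k :=
        Finset.sum_le_sum_of_subset_of_nonneg (Finset.range_mono (by omega)) fun k _ _ => hb0 k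
    _ = 2 * q + ∑ l ∈ Finset.range L, ((3 : ℝ) / 4) ^ l := by
        rw [Finset.sum_range_add]
        congr 1
        · rw [Finset.sum_congr rfl fun k hk => if_pos (Finset.mem_range.1 hk)]
          simp
        · exact Finset.sum_congr rfl fun l _ => by simp [b]
    _ ≤ 2 * q + 4 := by linarith

theorem le_expect_hops {q : ℕ} (hq1 : 1 ≤ q) (hq : q * M < h) (h1 : 1 ≤ r) (hr : r ≤ h) :
    min (hopsToHelper K (Y i) : ℝ) q / 2 ≤
      Finset.expect Finset.univ fun c : Caches n M h => (hops K Y c i r : ℝ) := by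
  classical
  have hdec : (Finset.expect Finset.univ fun c : Caches n M h =>
      if Decodable K Y c i r (q - 1) then (1 : ℝ) else 0) ≤ 1 / 2 := by
    refine (expect_decodable_le K Y i (q - 1) h1 hr).trans ?_
    have hS := ncard_servers_le K Y i (q - 1)
    rw [Nat.sub_add_cancel hq1] at hS
    have hle : (servers K Y i (q - 1)).ncard * M + 1 ≤ h :=
      (Nat.succ_le_succ (Nat.mul_le_mul_right M hS)).trans hq
    rw [div_le_div_iff₀ (by positivity) (by norm_num), one_mul, ← pow_succ]
    exact pow_le_pow_right₀ (by norm_num) hle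
  have hpt : ∀ c : Caches n M h, min (hopsToHelper K (Y i) : ℝ) q *
      (1 - if Decodable K Y c i r (q - 1) then (1 : ℝ) else 0) ≤ hops K Y c i r := by
    intro c
    split_ifs with hd
    · simp
    · have := le_hops_of_not_decodable hd
      rw [Nat.sub_add_cancel hq1] at this
      rw [sub_zero, mul_one]
      exact_mod_cast this
  have hm0 : (0 : ℝ) ≤ min (hopsToHelper K (Y i) : ℝ) q := by positivity
  calc min (hopsToHelper K (Y i) : ℝ) q / 2
      ≤ min (hopsToHelper K (Y i) : ℝ) q * (1 - Finset.expect Finset.univ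
        fun c : Caches n M h => if Decodable K Y c i r (q - 1) then (1 : ℝ) else 0) := by
        rw [div_eq_mul_one_div]
        exact mul_le_mul_of_nonneg_left (by linarith) hm0
    _ = Finset.expect Finset.univ fun c : Caches n M h => min (hopsToHelper K (Y i) : ℝ) q *
        (1 - if Decodable K Y c i r (q - 1) then (1 : ℝ) else 0) := by
        rw [← Finset.mul_expect, Finset.expect_sub_distrib, Fintype.expect_const]
    _ ≤ _ := Finset.expect_le_expect fun c _ => hpt c

theorem expect_hops_pos (h1 : 1 ≤ r) :
    0 < Finset.expect Finset.univ fun c : Caches n M h => (hops K Y c i r : ℝ) := by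
  rw [Finset.expect_eq_sum_div_card]
  refine div_pos (Finset.sum_pos' (fun c _ => Nat.cast_nonneg _) ⟨0, Finset.mem_univ _, ?_⟩)
    (by exact_mod_cast Finset.card_pos.2 Finset.univ_nonempty)
  unfold hops
  split_ifs with hr
  · have hnd : ∀ k, ¬ Decodable K Y (0 : Caches n M h) i r k := by
      intro k hk
      refine contentVec_ne_zero h1 hr ?_
      rw [← Submodule.mem_bot (ZMod 2)]
      refine Submodule.span_le.2 ?_ hk
      rintro _ ⟨j, -, a, rfl⟩
      simp
    simp only [hnd, false_or]
    have : sInf {k : ℕ | k = hopsToHelper K (Y i)} = hopsToHelper K (Y i) := by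
      exact csInf_singleton _
    rw [this]
    exact_mod_cast one_le_hopsToHelper K (Y i)
  · exact_mod_cast one_le_hopsToHelper K (Y i)

end Hops

/-! ### Zipf popularity -/

theorem zipf_nonneg (s : ℝ) (m i : ℕ) : 0 ≤ zipf s m i :=
  div_nonneg (by positivity) (Finset.sum_nonneg fun j _ => by positivity)

theorem one_le_zipf_norm (s : ℝ) {m : ℕ} (hm : 1 ≤ m) :
    1 ≤ ∑ j ∈ Finset.Icc 1 m, (j : ℝ) ^ (-s) := by
  calc (1 : ℝ) = ((1 : ℕ) : ℝ) ^ (-s) := by simp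
    _ ≤ _ := Finset.single_le_sum (f := fun j : ℕ => (j : ℝ) ^ (-s))
      (fun j _ => by positivity) (Finset.mem_Icc.2 ⟨le_rfl, hm⟩)

theorem zipf_pos (s : ℝ) {m i : ℕ} (hm : 1 ≤ m) (hi : 1 ≤ i) : 0 < zipf s m i := by
  refine div_pos ?_ (zero_lt_one.trans_le (one_le_zipf_norm s hm))
  have : (0 : ℝ) < i := by exact_mod_cast hi
  positivity

theorem sum_zipf (s : ℝ) {m : ℕ} (hm : 1 ≤ m) : ∑ i ∈ Finset.Icc 1 m, zipf s m i = 1 := by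
  simp only [zipf]
  rw [← Finset.sum_div, div_self]
  exact (zero_lt_one.trans_le (one_le_zipf_norm s hm)).ne'

theorem popularMass_eq_sum_filter (s : ℝ) (m h : ℕ) :
    popularMass s m h = ∑ i ∈ (Finset.Icc 1 m).filter (· ≤ h), zipf s m i := by
  rw [popularMass]
  congr 1
  ext i
  simp only [Finset.mem_Icc, Finset.mem_filter]
  omega

theorem sum_zipf_filter_not_le (s : ℝ) {m : ℕ} (hm : 1 ≤ m) (h : ℕ) :
    ∑ i ∈ (Finset.Icc 1 m).filter (fun i => ¬ i ≤ h), zipf s m i = 1 - popularMass s m h := by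
  rw [popularMass_eq_sum_filter, eq_sub_iff_add_eq, add_comm,
    Finset.sum_filter_add_sum_filter_not, sum_zipf s hm]

theorem popularMass_nonneg (s : ℝ) (m h : ℕ) : 0 ≤ popularMass s m h :=
  Finset.sum_nonneg fun i _ => zipf_nonneg s m i

/-- The contents beyond `h` are requested with probability `O(h^{-(s - s')})` for `1 < s' < s`. -/
theorem one_sub_popularMass_le {s s' : ℝ} (hs' : 1 < s') (hss : s' < s) {m h : ℕ} (hm : 1 ≤ m)
    (hh : 1 ≤ h) :
    1 - popularMass s m h ≤ (∑' j : ℕ, (j : ℝ) ^ (-s')) * (h : ℝ) ^ (-(s - s')) := by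
  have hh0 : (0 : ℝ) < h := by exact_mod_cast hh
  have hsum : Summable fun j : ℕ => (j : ℝ) ^ (-s') := Real.summable_nat_rpow.2 (by linarith)
  rw [← sum_zipf_filter_not_le s hm h]
  calc _ ≤ ∑ i ∈ (Finset.Icc 1 m).filter (fun i => ¬ i ≤ h),
        (i : ℝ) ^ (-s') * (h : ℝ) ^ (-(s - s')) := by
        refine Finset.sum_le_sum fun i hi => ?_
        have hi' : (h : ℝ) ≤ i := by
          have := (Finset.mem_filter.1 hi).2
          exact_mod_cast (not_le.1 this).le
        refine (div_le_self (by positivity) (one_le_zipf_norm s hm)).trans ?_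
        rw [show -s = -s' + -(s - s') by ring, Real.rpow_add (hh0.trans_le hi')]
        exact mul_le_mul_of_nonneg_left
          (Real.rpow_le_rpow_of_nonpos hh0 hi' (by linarith)) (by positivity)
    _ = (∑ i ∈ (Finset.Icc 1 m).filter (fun i => ¬ i ≤ h), (i : ℝ) ^ (-s')) *
        (h : ℝ) ^ (-(s - s')) := (Finset.sum_mul _ _ _).symm
    _ ≤ _ := mul_le_mul_of_nonneg_right
        (hsum.sum_le_tsum _ fun j _ => by positivity) (by positivity)

/-! ### Average number of hops and capacity -/

section Average
variable {n M h : ℕ} {K : ℕ} {Y : Fin n → ℝ × ℝ} {s : ℝ} {m : ℕ}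

theorem avgHops_le (hn : 1 ≤ n) (hm : 1 ≤ m) (hK : 0 < K) (hocc : AllOccupied K Y)
    (hy : ∀ i, Y i ∈ Set.Ico (0 : ℝ) 1 ×ˢ Set.Ico (0 : ℝ) 1) {q : ℕ} (hM : 1 ≤ M)
    (hq : h ≤ q * M) :
    avgHops s m M h K Y ≤ (2 * q + 4) + (1 - popularMass s m h) * (2 * K + 2) := by
  have : Nonempty (Fin n) := ⟨⟨0, hn⟩⟩
  refine Finset.expect_le Finset.univ_nonempty fun i _ => ?_
  have hpt : ∀ r, (Finset.expect Finset.univ fun c : Caches n M h => (hops K Y c i r : ℝ)) ≤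
      (2 * q + 4) + if ¬ r ≤ h then (2 * K + 2 : ℝ) else 0 := by
    intro r
    by_cases hr : r ≤ h
    · simpa [hr] using expect_hops_le hK hocc (hy i) hM hq hr
    · rw [if_pos hr]
      refine (Finset.expect_le Finset.univ_nonempty fun c _ => ?_).trans
        (le_add_of_nonneg_left (by positivity))
      exact_mod_cast (hops_le_hopsToHelper.trans (hopsToHelper_le (hy i)))
  calc _ ≤ ∑ r ∈ Finset.Icc 1 m, zipf s m r *
        ((2 * q + 4) + if ¬ r ≤ h then (2 * K + 2 : ℝ) else 0) :=
        Finset.sum_le_sum fun r _ => mul_le_mul_of_nonneg_left (hpt r) (zipf_nonneg s m r)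
    _ = _ := by
        simp only [mul_add (zipf s m _) (2 * q + 4 : ℝ), Finset.sum_add_distrib, mul_ite, mul_zero]
        rw [← Finset.sum_filter, ← Finset.sum_mul, ← Finset.sum_mul, sum_zipf s hm, sum_zipf_filter_not_le s hm, one_mul]

theorem le_avgHops {q : ℕ} (hq1 : 1 ≤ q) (hq : q * M < h) {F : Finset (Fin n)}
    (hF : n ≤ 2 * F.card) (hn : 1 ≤ n) {b : ℝ} (hb0 : 0 ≤ b) (hbq : b ≤ q)
    (hbF : ∀ i ∈ F, b ≤ hopsToHelper K (Y i)) :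
    popularMass s m h * b / 4 ≤ avgHops s m M h K Y := by
  have hn' : (0 : ℝ) < n := by exact_mod_cast hn
  have hF' : (n : ℝ) ≤ 2 * F.card := by exact_mod_cast hF
  have hnn : ∀ i, 0 ≤ ∑ r ∈ Finset.Icc 1 m, zipf s m r *
      Finset.expect Finset.univ fun c : Caches n M h => (hops K Y c i r : ℝ) := fun i =>
    Finset.sum_nonneg fun r _ => mul_nonneg (zipf_nonneg s m r)
      (Finset.expect_nonneg fun c _ => Nat.cast_nonneg _)
  have hi : ∀ i ∈ F, popularMass s m h * (b / 2) ≤ ∑ r ∈ Finset.Icc 1 m, zipf s m r *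
      Finset.expect Finset.univ fun c : Caches n M h => (hops K Y c i r : ℝ) := by
    intro i hiF
    rw [popularMass_eq_sum_filter, Finset.sum_mul]
    refine (Finset.sum_le_sum fun r hr => ?_).trans (Finset.sum_le_sum_of_subset_of_nonneg
      (Finset.filter_subset _ _) fun r _ _ => mul_nonneg (zipf_nonneg s m r)
        (Finset.expect_nonneg fun c _ => Nat.cast_nonneg _))
    obtain ⟨hr1, hr2⟩ := Finset.mem_filter.1 hr
    refine mul_le_mul_of_nonneg_left ?_ (zipf_nonneg s m r)
    refine le_trans ?_ (le_expect_hops hq1 hq (Finset.mem_Icc.1 hr1).1 hr2)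
    have := le_min (hbF i hiF) hbq
    linarith
  rw [avgHops, Finset.expect_eq_sum_div_card, Finset.card_univ, Fintype.card_fin, le_div_iff₀ hn']
  calc popularMass s m h * b / 4 * n ≤ popularMass s m h * b / 4 * (2 * F.card) :=
        mul_le_mul_of_nonneg_left hF' (by have := popularMass_nonneg s m h; positivity)
    _ = ∑ i ∈ F, popularMass s m h * (b / 2) := by
        rw [Finset.sum_const, nsmul_eq_mul]
        ring
    _ ≤ _ := (Finset.sum_le_sum hi).trans
        (Finset.sum_le_sum_of_subset_of_nonneg (Finset.subset_univ _) fun i _ _ => hnn i)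

theorem avgHops_pos (hn : 1 ≤ n) (hm : 1 ≤ m) : 0 < avgHops s m M h K Y := by
  have : Nonempty (Fin n) := ⟨⟨0, hn⟩⟩
  refine Finset.expect_pos (fun i _ => Finset.sum_pos (fun r hr => ?_) ⟨1, by simpa using hm⟩)
    Finset.univ_nonempty
  have hr := (Finset.mem_Icc.1 hr).1
  exact mul_pos (zipf_pos s hm hr) (expect_hops_pos hr)

theorem capacity_eq (hn : 1 ≤ n) (hm : 1 ≤ m) (W Δ C₁ R : ℝ) :
    capacity W Δ C₁ R s m M h Y =
      deliverable W Δ C₁ R / (n * avgHops s m M h (gridSize C₁ R) Y) := by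
  have hn' : (0 : ℝ) < n := by exact_mod_cast hn
  have hpos := mul_pos hn' (avgHops_pos (s := s) (M := M) (h := h) (K := gridSize C₁ R) (Y := Y) hn hm)
  have : {l : ℝ | n * l * avgHops s m M h (gridSize C₁ R) Y ≤ deliverable W Δ C₁ R} =
      Set.Iic (deliverable W Δ C₁ R / (n * avgHops s m M h (gridSize C₁ R) Y)) := by
    ext l
    rw [Set.mem_Iic, le_div_iff₀ hpos, ← mul_assoc, mul_comm l]
    rfl
  rw [capacity, this, csSup_Iic]

end Average

/-! ### Random deployments -/

/-- Uniform distribution on the unit square. -/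
noncomputable abbrev unitSquare : Measure (ℝ × ℝ) :=
  (volume : Measure (ℝ × ℝ)).restrict (Set.Icc 0 1 ×ˢ Set.Icc 0 1)

theorem unitSquare_prod_le (s t : Set ℝ) : unitSquare (s ×ˢ t) ≤
    volume (s ∩ Set.Icc 0 1) * volume (t ∩ Set.Icc 0 1) := by
  have hms : MeasurableSet (Set.Icc (0 : ℝ) 1 ×ˢ Set.Icc (0 : ℝ) 1) :=
    measurableSet_Icc.prod measurableSet_Icc
  rw [unitSquare, Measure.restrict_apply' hms, Set.prod_inter_prod, Measure.volume_eq_prod,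
    Measure.prod_prod]

instance : IsProbabilityMeasure unitSquare :=
  ⟨by rw [unitSquare, Measure.restrict_apply_univ, Measure.volume_eq_prod, Measure.prod_prod]; simp⟩

instance (n : ℕ) : IsProbabilityMeasure (deployment n) := by
  unfold deployment
  infer_instance

theorem deployment_pi (n : ℕ) (B : Fin n → Set (ℝ × ℝ)) :
    deployment n (Set.univ.pi B) = ∏ i, unitSquare (B i) := Measure.pi_pi _ _

theorem deployment_not_mem_Ico (n : ℕ) :
    deployment n {Y | ∀ i, Y i ∈ Set.Ico (0 : ℝ) 1 ×ˢ Set.Ico (0 : ℝ) 1}ᶜ = 0 := by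
  have h1 : ∀ᵐ y ∂unitSquare, y ∈ Set.Ico (0 : ℝ) 1 ×ˢ Set.Ico (0 : ℝ) 1 := by
    have hsub : (Set.Icc (0 : ℝ) 1 ×ˢ Set.Icc (0 : ℝ) 1) \ (Set.Ico (0 : ℝ) 1 ×ˢ Set.Ico (0 : ℝ) 1)
        ⊆ ({1} ×ˢ Set.univ) ∪ (Set.univ ×ˢ {1}) := by
      rintro ⟨a, b⟩ ⟨⟨ha, hb⟩, h⟩
      by_contra hne
      simp only [Set.mem_union, Set.mem_prod, Set.mem_singleton_iff, Set.mem_univ, and_true,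
        true_and, not_or] at hne
      exact h ⟨⟨ha.1, lt_of_le_of_ne ha.2 hne.1⟩, ⟨hb.1, lt_of_le_of_ne hb.2 hne.2⟩⟩
    rw [unitSquare, ae_restrict_iff' (measurableSet_Icc.prod measurableSet_Icc), ae_iff]
    refine measure_mono_null (t := ({1} ×ˢ Set.univ) ∪ (Set.univ ×ˢ {1})) ?_
      (measure_union_null ?_ ?_)
    · intro y hy
      simp only [Classical.not_imp] at hy
      exact hsub hy
    · rw [Measure.volume_eq_prod, Measure.prod_prod]
      simp
    · rw [Measure.volume_eq_prod, Measure.prod_prod]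
      simp
  have h2 : ∀ᵐ Y ∂deployment n, ∀ i, Y i ∈ Set.Ico (0 : ℝ) 1 ×ˢ Set.Ico (0 : ℝ) 1 := by
    rw [ae_all_iff]
    intro i
    exact (Measure.tendsto_eval_ae_ae (μ := fun _ : Fin n => unitSquare) (i := i)).eventually h1
  exact h2

theorem floor_mul_eq_iff {K : ℕ} (hK : 0 < K) (x : ℝ) (a : ℤ) :
    ⌊(K : ℝ) * x⌋ = a ↔ x ∈ Set.Ico ((a : ℝ) / K) ((a + 1) / K) := by
  have hK' : (0 : ℝ) < K := by exact_mod_cast hK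
  rw [Int.floor_eq_iff, Set.mem_Ico, div_le_iff₀ hK', lt_div_iff₀ hK', mul_comm]

theorem unitSquare_squarelet {K : ℕ} (hK : 0 < K) {a b : ℤ} (ha : 0 ≤ a) (ha' : a < K)
    (hb : 0 ≤ b) (hb' : b < K) :
    unitSquare {y | squarelet K y = (a, b)} = ENNReal.ofReal (1 / (K : ℝ) ^ 2) := by
  have hK' : (0 : ℝ) < K := by exact_mod_cast hK
  have hset : {y | squarelet K y = (a, b)} =
      Set.Ico ((a : ℝ) / K) ((a + 1) / K) ×ˢ Set.Ico ((b : ℝ) / K) ((b + 1) / K) := by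
    ext y
    simp only [squarelet, Prod.mk.injEq, Set.mem_prod, ← floor_mul_eq_iff hK]
    rfl
  have hsub : ∀ {c : ℤ}, 0 ≤ c → c < K →
      Set.Ico ((c : ℝ) / K) ((c + 1) / K) ⊆ Set.Icc 0 1 := by
    intro c hc hc' x hx
    have h0 : (0 : ℝ) ≤ c := by exact_mod_cast hc
    have h1 : (c : ℝ) + 1 ≤ K := by exact_mod_cast hc'
    exact ⟨(div_nonneg h0 hK'.le).trans hx.1, hx.2.le.trans ((div_le_one hK').2 h1)⟩
  rw [hset, unitSquare, Measure.restrict_eq_self _ (Set.prod_mono (hsub ha ha') (hsub hb hb')),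
    Measure.volume_eq_prod, Measure.prod_prod, Real.volume_Ico, Real.volume_Ico,
    ← ENNReal.ofReal_mul (by rw [← sub_div, add_sub_cancel_left]; positivity)]
  congr 1
  field_simp
  ring

theorem deployment_not_allOccupied_le {n K : ℕ} (hK : 0 < K) :
    deployment n {Y | AllOccupied K Y}ᶜ ≤
      ENNReal.ofReal ((K : ℝ) ^ 2 * Real.exp (-(n / (K : ℝ) ^ 2))) := by
  have hK' : (0 : ℝ) < K := by exact_mod_cast hK
  have hK1 : (1 : ℝ) ≤ K := by exact_mod_cast hK
  have hsub : {Y : Fin n → ℝ × ℝ | AllOccupied K Y}ᶜ ⊆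
      ⋃ p ∈ Finset.range K ×ˢ Finset.range K,
        Set.univ.pi fun _ : Fin n => {y | squarelet K y = ((p.1 : ℤ), (p.2 : ℤ))}ᶜ := by
    intro Y hY
    simp only [AllOccupied, Set.mem_compl_iff, Set.mem_ofPred_eq, not_forall, not_exists] at hY
    obtain ⟨a, b, ha, ha', hb, hb', hne⟩ := hY
    lift a to ℕ using ha
    lift b to ℕ using hb
    simp only [Set.mem_iUnion]
    refine ⟨(a, b), Finset.mem_product.2 ⟨?_, ?_⟩, fun i _ => hne i⟩
    · simpa using ha'
    · simpa using hb'
  have hpt : ∀ p ∈ Finset.range K ×ˢ Finset.range K,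
      deployment n (Set.univ.pi fun _ : Fin n => {y | squarelet K y = ((p.1 : ℤ), (p.2 : ℤ))}ᶜ) ≤
        ENNReal.ofReal (Real.exp (-(n / (K : ℝ) ^ 2))) := by
    intro p hp
    obtain ⟨h1, h2⟩ := Finset.mem_product.1 hp
    have hmeas : MeasurableSet {y | squarelet K y = ((p.1 : ℤ), (p.2 : ℤ))} := by
      have : Measurable (squarelet K) := by
        unfold squarelet
        fun_prop
      exact this (measurableSet_singleton _)
    have hle1 : 1 / (K : ℝ) ^ 2 ≤ 1 := (div_le_one (by positivity)).2 (one_le_pow₀ hK1)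
    rw [deployment_pi, Finset.prod_const, Finset.card_univ, Fintype.card_fin,
      prob_compl_eq_one_sub hmeas, unitSquare_squarelet hK (by simp)
        (by simpa using h1) (by simp) (by simpa using h2), ← ENNReal.ofReal_one,
      ← ENNReal.ofReal_sub _ (by positivity), ← ENNReal.ofReal_pow (by linarith)]
    refine ENNReal.ofReal_le_ofReal ?_
    calc (1 - 1 / (K : ℝ) ^ 2) ^ n ≤ Real.exp (-(1 / (K : ℝ) ^ 2)) ^ n :=
          pow_le_pow_left₀ (by linarith) (Real.one_sub_le_exp_neg _) n
      _ = _ := by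
          rw [← Real.exp_nat_mul]
          congr 1
          ring
  calc _ ≤ ∑ p ∈ Finset.range K ×ˢ Finset.range K, deployment n
        (Set.univ.pi fun _ : Fin n => {y | squarelet K y = ((p.1 : ℤ), (p.2 : ℤ))}ᶜ) :=
        (measure_mono hsub).trans (measure_biUnion_finset_le _ _)
    _ ≤ ∑ p ∈ Finset.range K ×ˢ Finset.range K, ENNReal.ofReal (Real.exp (-(n / (K : ℝ) ^ 2))) :=
        Finset.sum_le_sum hpt
    _ = _ := by
        rw [Finset.sum_const, Finset.card_product, Finset.card_range, nsmul_eq_mul,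
          ENNReal.ofReal_mul (by positivity), ← sq, ← ENNReal.ofReal_natCast]
        push_cast
        rfl

/-- Terminals that are far from the helper in the horizontal direction. -/
noncomputable def farTerminals {n : ℕ} (Y : Fin n → ℝ × ℝ) : Finset (Fin n) :=
  open Classical in Finset.univ.filter fun i => 1 / 32 ≤ |(Y i).1 - 1 / 2|

theorem deployment_few_far_le (n : ℕ) :
    deployment n {Y | n ≤ 2 * (farTerminals Y).card}ᶜ ≤ (2⁻¹ : ENNReal) ^ n := by
  classical
  let B : Set (ℝ × ℝ) := {y | |y.1 - 1 / 2| < 1 / 32}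
  have hB : unitSquare B ≤ 4⁻¹ ^ 2 := by
    have : B = Set.Ioo (15 / 32 : ℝ) (17 / 32) ×ˢ Set.univ := by
      ext y
      simp only [B, Set.mem_ofPred_eq, abs_lt, Set.mem_prod, Set.mem_Ioo, Set.mem_univ, and_true]
      constructor <;> rintro ⟨h1, h2⟩ <;> constructor <;> linarith
    rw [this]
    refine (unitSquare_prod_le _ _).trans ?_
    calc _ ≤ volume (Set.Ioo (15 / 32 : ℝ) (17 / 32)) * volume (Set.Icc (0 : ℝ) 1) := by
          gcongr
          · exact Set.inter_subset_left
          · exact Set.inter_subset_right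
      _ = ENNReal.ofReal (4⁻¹ ^ 2) := by
          rw [Real.volume_Ioo, Real.volume_Icc]
          norm_num
      _ = 4⁻¹ ^ 2 := by
          rw [ENNReal.ofReal_pow (by norm_num), ENNReal.ofReal_inv_of_pos (by norm_num)]
          norm_num
  have hsub : {Y : Fin n → ℝ × ℝ | n ≤ 2 * (farTerminals Y).card}ᶜ ⊆
      ⋃ T ∈ Finset.univ.filter (fun T : Finset (Fin n) => n ≤ 2 * T.card),
        Set.univ.pi fun i => if i ∈ T then B else Set.univ := by
    intro Y hY
    simp only [Set.mem_compl_iff, Set.mem_ofPred_eq, not_le] at hY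
    simp only [Set.mem_iUnion]
    refine ⟨(farTerminals Y)ᶜ, ?_, ?_⟩
    · simp only [Finset.mem_filter, Finset.mem_univ, true_and, Finset.card_compl, Fintype.card_fin]
      omega
    · intro i _
      beta_reduce
      split_ifs with hi
      · simpa [farTerminals, B] using hi
      · trivial
  have hpt : ∀ T ∈ Finset.univ.filter (fun T : Finset (Fin n) => n ≤ 2 * T.card),
      deployment n (Set.univ.pi fun i => if i ∈ T then B else Set.univ) ≤ 4⁻¹ ^ n := by
    intro T hT
    have hT := (Finset.mem_filter.1 hT).2
    rw [deployment_pi]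
    calc ∏ i, unitSquare (if i ∈ T then B else Set.univ)
        = ∏ i, if i ∈ T then unitSquare B else 1 :=
          Finset.prod_congr rfl fun i _ => by split_ifs <;> simp
      _ = unitSquare B ^ T.card := by
          rw [Finset.prod_ite_mem, Finset.univ_inter, Finset.prod_const]
      _ ≤ (4⁻¹ ^ 2) ^ T.card := pow_le_pow_left' hB _
      _ = 4⁻¹ ^ (2 * T.card) := (pow_mul _ _ _).symm
      _ ≤ 4⁻¹ ^ n := pow_le_pow_right_of_le_one' (by simp) hT
  calc _ ≤ ∑ T ∈ Finset.univ.filter (fun T : Finset (Fin n) => n ≤ 2 * T.card),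
        deployment n (Set.univ.pi fun i => if i ∈ T then B else Set.univ) :=
        (measure_mono hsub).trans (measure_biUnion_finset_le _ _)
    _ ≤ ∑ T ∈ Finset.univ.filter (fun T : Finset (Fin n) => n ≤ 2 * T.card), 4⁻¹ ^ n :=
        Finset.sum_le_sum hpt
    _ ≤ ∑ T : Finset (Fin n), 4⁻¹ ^ n :=
        Finset.sum_le_sum_of_subset (Finset.subset_univ _)
    _ = 2⁻¹ ^ n := by
        rw [Finset.sum_const, Finset.card_univ, Fintype.card_finset, Fintype.card_fin,
          nsmul_eq_mul, Nat.cast_pow, ← mul_pow]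
        congr 1
        rw [show (4 : ENNReal) = 2 * 2 by norm_num, ENNReal.mul_inv (by simp) (by simp),
          ← mul_assoc, Nat.cast_ofNat, ENNReal.mul_inv_cancel (by simp) (by simp), one_mul]

theorem WHP.mono {E F : ∀ n : ℕ, Set (Fin n → ℝ × ℝ)} (hE : WHP E)
    (h : ∀ᶠ n in atTop, E n ⊆ F n) : WHP F :=
  tendsto_of_tendsto_of_tendsto_of_le_of_le' tendsto_const_nhds hE
    (Eventually.of_forall fun _ => zero_le)
    (h.mono fun _ hn => measure_mono (Set.compl_subset_compl.2 hn))

theorem WHP.inter {E F : ∀ n : ℕ, Set (Fin n → ℝ × ℝ)} (hE : WHP E) (hF : WHP F) :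
    WHP fun n => E n ∩ F n := by
  have := Tendsto.add hE hF
  rw [add_zero] at this
  refine tendsto_of_tendsto_of_tendsto_of_le_of_le tendsto_const_nhds this
    (fun _ => zero_le) fun n => ?_
  simp only [Set.compl_inter]
  exact measure_union_le _ _

theorem whp_Ico : WHP fun _ => {Y | ∀ i, Y i ∈ Set.Ico (0 : ℝ) 1 ×ˢ Set.Ico (0 : ℝ) 1} := by
  simp only [WHP, deployment_not_mem_Ico]
  exact tendsto_const_nhds

theorem whp_far : WHP fun n => {Y | n ≤ 2 * (farTerminals Y).card} :=
  tendsto_of_tendsto_of_tendsto_of_le_of_le tendsto_const_nhds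
    (ENNReal.tendsto_pow_atTop_nhds_zero_of_lt_one ENNReal.one_half_lt_one)
    (fun _ => zero_le) deployment_few_far_le

theorem whp_allOccupied {K : ℕ → ℕ} (hK : ∀ᶠ n in atTop, 0 < K n)
    (hKn : ∀ᶠ n : ℕ in atTop, (K n : ℝ) ^ 2 ≤ n / Real.log n) :
    WHP fun n => {Y | AllOccupied (K n) Y} := by
  have hlog : Tendsto (fun n : ℕ => Real.log n) atTop atTop :=
    Real.tendsto_log_atTop.comp tendsto_natCast_atTop_atTop
  have hlim : Tendsto (fun n : ℕ => ENNReal.ofReal (Real.log n)⁻¹) atTop (𝓝 0) := by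
    rw [← ENNReal.ofReal_zero]
    exact (ENNReal.continuous_ofReal.tendsto _).comp hlog.inv_tendsto_atTop
  refine tendsto_of_tendsto_of_tendsto_of_le_of_le' tendsto_const_nhds hlim
    (Eventually.of_forall fun _ => zero_le) ?_
  filter_upwards [hK, hKn, hlog.eventually_gt_atTop 0, eventually_gt_atTop 0] with n h0 h1 h2 h3
  refine (deployment_not_allOccupied_le h0).trans (ENNReal.ofReal_le_ofReal ?_)
  have h0' : (0 : ℝ) < (K n : ℝ) ^ 2 := by positivity
  have h3' : (0 : ℝ) < n := by exact_mod_cast h3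
  have hle : Real.log n ≤ n / (K n : ℝ) ^ 2 := by
    rw [le_div_iff₀ h2] at h1
    rw [le_div_iff₀ h0', mul_comm]
    exact h1
  calc (K n : ℝ) ^ 2 * Real.exp (-(n / (K n : ℝ) ^ 2))
      ≤ n / Real.log n * Real.exp (-Real.log n) := by gcongr
    _ = (Real.log n)⁻¹ := by
        rw [Real.exp_neg, Real.exp_log h3']
        field_simp

/-! ### Asymptotics -/

theorem eventually_log_pos : ∀ᶠ n : ℕ in atTop, 0 < Real.log n :=
  (Real.tendsto_log_atTop.comp tendsto_natCast_atTop_atTop).eventually_gt_atTop 0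

theorem tendsto_natCast_rpow {p : ℝ} (hp : 0 < p) :
    Tendsto (fun n : ℕ => (n : ℝ) ^ p) atTop atTop :=
  (tendsto_rpow_atTop hp).comp tendsto_natCast_atTop_atTop

theorem eventually_mul_rpow_mul_sqrt_le {δ : ℝ} (hδ : δ < 1 / 2) {C : ℝ} (hC : 0 < C) :
    ∀ᶠ n : ℕ in atTop, C * (n : ℝ) ^ δ * √(Real.log n / n) ≤ 1 := by
  have h1 := (isLittleO_log_rpow_atTop (r := 1 - 2 * δ) (by linarith)).bound
    (show (0 : ℝ) < 1 / C ^ 2 by positivity)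
  filter_upwards [tendsto_natCast_atTop_atTop.eventually h1, eventually_gt_atTop 0,
    eventually_log_pos] with n hn hn0 hlog
  have hn0' : (0 : ℝ) < n := by exact_mod_cast hn0
  rw [Real.norm_of_nonneg hlog.le, Real.norm_of_nonneg (by positivity), Real.rpow_sub hn0',
    Real.rpow_one, mul_comm 2 δ, Real.rpow_mul hn0'.le, Real.rpow_two] at hn
  have hp : (0 : ℝ) < (n : ℝ) ^ δ := by positivity
  refine (sq_le_one_iff₀ (by positivity)).1 ?_
  rw [mul_pow, mul_pow, Real.sq_sqrt (by positivity), ← mul_div_assoc, div_le_one hn0']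
  calc (C ^ 2 * ((n : ℝ) ^ δ) ^ 2 * Real.log n : ℝ)
      ≤ C ^ 2 * ((n : ℝ) ^ δ) ^ 2 * (1 / C ^ 2 * (n / ((n : ℝ) ^ δ) ^ 2)) := by gcongr
    _ = (n : ℝ) := by field_simp

theorem capacity_bounds {n m M h : ℕ} {Y : Fin n → ℝ × ℝ} {s W Δ C₁ R lo hi : ℝ} (hn : 1 ≤ n)
    (hm : 1 ≤ m) (hW : 0 < W) (hΔ : 0 < Δ) (hC₁ : 0 < C₁) (hlog : 0 < Real.log n) (hlo : 0 < lo)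
    (h1 : lo * √(Real.log n / n) ≤ R) (h2 : R ≤ hi * √(Real.log n / n)) :
    W / ((2 + Δ) * hi) ^ 2 / (Real.log n * avgHops s m M h (gridSize C₁ R) Y) ≤
        capacity W Δ C₁ R s m M h Y ∧
      capacity W Δ C₁ R s m M h Y ≤
        W / ((2 + Δ) * lo) ^ 2 / (Real.log n * avgHops s m M h (gridSize C₁ R) Y) := by
  have hn' : (0 : ℝ) < n := by exact_mod_cast hn
  have hA := avgHops_pos (s := s) (M := M) (h := h) (K := gridSize C₁ R) (Y := Y) hn hm
  set A := avgHops s m M h (gridSize C₁ R) Y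
  set u := √(Real.log n / n) with hu
  have hu0 : 0 < u := Real.sqrt_pos.2 (by positivity)
  have hR : 0 < R := (mul_pos hlo hu0).trans_le h1
  have hhi : 0 < hi := pos_of_mul_pos_left (hR.trans_le h2) hu0.le
  have hu2 : u ^ 2 * n = Real.log n := by
    rw [hu, Real.sq_sqrt (by positivity), div_mul_cancel₀ _ hn'.ne']
  have hcap : capacity W Δ C₁ R s m M h Y = W / (((2 + Δ) * R) ^ 2 * n * A) := by
    rw [capacity_eq hn hm, deliverable, div_mul_cancel₀ _ hC₁.ne', div_div, mul_assoc _ (n : ℝ) A]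
  have hform : ∀ x : ℝ, W / ((2 + Δ) * x) ^ 2 / (Real.log n * A) =
      W / (((2 + Δ) * (x * u)) ^ 2 * n * A) := by
    intro x
    rw [← hu2, div_div]
    congr 1
    ring
  rw [hcap, hform, hform]
  constructor
  · gcongr
  · gcongr

theorem eventually_one_sub_popularMass_le {s γ : ℝ} (hγ : 0 < γ)
    (hsγ : 1 / 2 < (s - 1) * γ) {m h : ℕ → ℕ} (hm : ∀ᶠ n in atTop, 1 ≤ m n) {lo : ℝ} (hlo : 0 < lo)
    (hh : ∀ᶠ n : ℕ in atTop, lo * (n : ℝ) ^ γ ≤ h n) :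
    ∀ᶠ n : ℕ in atTop, 1 - popularMass s (m n) (h n) ≤ 1 / √(n : ℝ) := by
  obtain ⟨e, he1, he2, he3⟩ : ∃ e : ℝ, 0 < e ∧ e < s - 1 ∧ 1 / 2 < e * γ := by
    have h1 : 1 / (2 * γ) < s - 1 := by
      rw [div_lt_iff₀ (by positivity)]
      linarith
    obtain ⟨e, h2, h3⟩ := exists_between h1
    refine ⟨e, lt_trans (by positivity) h2, h3, ?_⟩
    rw [div_lt_iff₀ (by positivity)] at h2
    linarith
  have hlim : Tendsto (fun n : ℕ => (∑' j : ℕ, (j : ℝ) ^ (-(s - e))) * lo ^ (-e) *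
      (n : ℝ) ^ (-(e * γ - 1 / 2))) atTop (𝓝 0) := by
    have := ((tendsto_rpow_neg_atTop (show 0 < e * γ - 1 / 2 by linarith)).comp
      tendsto_natCast_atTop_atTop).const_mul ((∑' j : ℕ, (j : ℝ) ^ (-(s - e))) * lo ^ (-e))
    rw [mul_zero] at this
    exact this
  filter_upwards [hm, hh, hlim.eventually_le_const zero_lt_one, eventually_gt_atTop 0]
    with n hm hh hle hn
  have hn' : (0 : ℝ) < n := by exact_mod_cast hn
  have hpos : 0 < lo * (n : ℝ) ^ γ := by positivity
  have hh1 : 1 ≤ h n := by exact_mod_cast hpos.trans_le hh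
  have hT : 0 ≤ ∑' j : ℕ, (j : ℝ) ^ (-(s - e)) := tsum_nonneg fun j => by positivity
  refine (one_sub_popularMass_le (s' := s - e) (by linarith) (by linarith) hm hh1).trans ?_
  rw [show s - (s - e) = e by ring]
  calc (∑' j : ℕ, (j : ℝ) ^ (-(s - e))) * (h n : ℝ) ^ (-e)
      ≤ (∑' j : ℕ, (j : ℝ) ^ (-(s - e))) * (lo * (n : ℝ) ^ γ) ^ (-e) :=
        mul_le_mul_of_nonneg_left (Real.rpow_le_rpow_of_nonpos hpos hh (by linarith)) hT
    _ = (∑' j : ℕ, (j : ℝ) ^ (-(s - e))) * lo ^ (-e) * (n : ℝ) ^ (-(e * γ - 1 / 2)) *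
        (n : ℝ) ^ (-(1 / 2) : ℝ) := by
        rw [Real.mul_rpow hlo.le (by positivity), ← Real.rpow_mul hn'.le, mul_assoc, mul_assoc,
          ← Real.rpow_add hn']
        congr 3
        ring
    _ ≤ 1 * (n : ℝ) ^ (-(1 / 2) : ℝ) := by gcongr
    _ = 1 / √(n : ℝ) := by rw [one_mul, Real.rpow_neg hn'.le, ← Real.sqrt_eq_rpow, one_div]

section Rates
variable {s β γ C₁ C₄ W Δ lo hi : ℝ} {m M h : ℕ → ℕ} {R : ℕ → ℝ}

theorem eventually_gridSize_sq_le
    (hocc : ∀ᶠ n : ℕ in atTop, √(Real.log n / n) ≤ C₁ * R n) :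
    ∀ᶠ n : ℕ in atTop, (gridSize C₁ (R n) : ℝ) ^ 2 ≤ n / Real.log n := by
  filter_upwards [hocc, eventually_log_pos, eventually_gt_atTop 0] with n h1 h2 h3
  have h3' : (0 : ℝ) < n := by exact_mod_cast h3
  have hu0 : 0 < √(Real.log n / n) := Real.sqrt_pos.2 (by positivity)
  have hle : (gridSize C₁ (R n) : ℝ) ≤ 1 / √(Real.log n / n) :=
    (Nat.floor_le (by have := hu0.trans_le h1; positivity)).trans
      (one_div_le_one_div_of_le hu0 h1)
  calc (gridSize C₁ (R n) : ℝ) ^ 2 ≤ (1 / √(Real.log n / n)) ^ 2 := by gcongr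
    _ = n / Real.log n := by
        rw [div_pow, Real.sq_sqrt (by positivity), one_pow, one_div_div]

theorem eventually_rpow_le_gridSize (hC₁ : 0 < C₁) (hhi : 0 < hi)
    (hRhi : ∀ᶠ n : ℕ in atTop, R n ≤ hi * √(Real.log n / n))
    (hocc : ∀ᶠ n : ℕ in atTop, √(Real.log n / n) ≤ C₁ * R n) {δ : ℝ} (hδ0 : 0 ≤ δ)
    (hδ : δ < 1 / 2) {C : ℝ} (hC : 0 < C) :
    ∀ᶠ n : ℕ in atTop, C * (n : ℝ) ^ δ ≤ gridSize C₁ (R n) := by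
  filter_upwards [hocc, hRhi, eventually_log_pos, eventually_gt_atTop 0,
    eventually_mul_rpow_mul_sqrt_le hδ (show 0 < (C + 1) * (C₁ * hi) by positivity)]
    with n h1 h2 h3 h4 h5
  have h4' : (0 : ℝ) < n := by exact_mod_cast h4
  have hu0 : 0 < √(Real.log n / n) := Real.sqrt_pos.2 (by positivity)
  have hp : 1 ≤ (n : ℝ) ^ δ := Real.one_le_rpow (by exact_mod_cast h4) hδ0
  have hCR : 0 < C₁ * R n := hu0.trans_le h1
  have hle : (C + 1) * (n : ℝ) ^ δ ≤ 1 / (C₁ * R n) := by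
    rw [le_div_iff₀ hCR]
    calc (C + 1) * (n : ℝ) ^ δ * (C₁ * R n)
        ≤ (C + 1) * (n : ℝ) ^ δ * (C₁ * (hi * √(Real.log n / n))) := by gcongr
      _ ≤ 1 := by
          refine le_trans (le_of_eq ?_) h5
          ring
  have := Nat.lt_floor_add_one (1 / (C₁ * R n))
  rw [gridSize]
  linarith

/-- Achievable rate of coding over `O(n ^ γ)` contents of probability `1 - O(1 / √n)`. -/
theorem exists_whp_le_capacity (hC₁ : 0 < C₁) (hC₄ : 0 < C₄) (hW : 0 < W) (hΔ : 0 < Δ)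
    (hβ : β ≤ γ) (hm : ∀ᶠ n in atTop, 1 ≤ m n)
    (hM : ∀ n : ℕ, |(M n : ℝ) - C₄ * (n : ℝ) ^ β| ≤ 1) (hM1 : ∀ᶠ n in atTop, 1 ≤ M n)
    (hhi : 0 < hi) (hRhi : ∀ᶠ n : ℕ in atTop, R n ≤ hi * √(Real.log n / n))
    (hocc : ∀ᶠ n : ℕ in atTop, √(Real.log n / n) ≤ C₁ * R n) {B : ℝ} (hB : 0 < B)
    (hh : ∀ᶠ n : ℕ in atTop, (h n : ℝ) ≤ B * (n : ℝ) ^ γ)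
    (hmass : ∀ᶠ n : ℕ in atTop, 1 - popularMass s (m n) (h n) ≤ 1 / √(n : ℝ)) :
    ∃ c : ℝ, 0 < c ∧ WHP fun n => {Y | AllOccupied (gridSize C₁ (R n)) Y ∧
      c * ((n : ℝ) ^ (β - γ) / Real.log n) ≤ capacity W Δ C₁ (R n) s (m n) (M n) (h n) Y} := by
  have hK0 : ∀ᶠ n : ℕ in atTop, 0 < gridSize C₁ (R n) := by
    filter_upwards [eventually_rpow_le_gridSize hC₁ hhi hRhi hocc le_rfl
      (show (0 : ℝ) < 1 / 2 by norm_num) zero_lt_one] with n hn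
    rw [Real.rpow_zero, mul_one] at hn
    exact_mod_cast hn
  have hK2 := eventually_gridSize_sq_le hocc
  set w := W / ((2 + Δ) * hi) ^ 2 with hw
  have hw0 : 0 < w := by positivity
  set D := 4 * B / C₄ + 10 with hD
  have hD0 : 0 < D := by positivity
  refine ⟨w / D, by positivity, ((whp_allOccupied hK0 hK2).inter whp_Ico).mono ?_⟩
  filter_upwards [hK0, hK2, hm, hM1, hRhi, hocc, hh, hmass, eventually_log_pos,
    eventually_ge_atTop 1, (Real.tendsto_log_atTop.comp
      tendsto_natCast_atTop_atTop).eventually_ge_atTop 1]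
    with n hK0 hK2 hm hM1 hRhi hocc hh hmass hlog hn hlog1
  rintro Y ⟨hY1, hY2⟩
  refine ⟨hY1, ?_⟩
  have hn0 : (0 : ℝ) < n := by exact_mod_cast hn
  have hn1 : (1 : ℝ) ≤ n := by exact_mod_cast hn
  have hM1' : (1 : ℝ) ≤ M n := by exact_mod_cast hM1
  have hlo : 1 / C₁ * √(Real.log n / n) ≤ R n := by
    rw [one_div, inv_mul_le_iff₀ hC₁]
    exact hocc
  refine le_trans ?_ (capacity_bounds hn hm hW hΔ hC₁ hlog (by positivity) hlo hRhi).1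
  have hApos := avgHops_pos (s := s) (M := M n) (h := h n) (K := gridSize C₁ (R n)) (Y := Y) hn hm
  have hA := avgHops_le (s := s) hn hm hK0 hY1 hY2 hM1
    (show h n ≤ (h n / M n + 1) * M n by
      rw [add_mul, one_mul]
      exact (Nat.lt_div_mul_add hM1).le)
  set A := avgHops s (m n) (M n) (h n) (gridSize C₁ (R n)) Y
  set K := gridSize C₁ (R n)
  have hp1 : 1 ≤ (n : ℝ) ^ (γ - β) := Real.one_le_rpow hn1 (by linarith)
  have hq : ((h n / M n : ℕ) : ℝ) ≤ 2 * B / C₄ * (n : ℝ) ^ (γ - β) := by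
    refine Nat.cast_div_le.trans ?_
    rw [div_le_iff₀ (by linarith)]
    have hM2 : C₄ / 2 * (n : ℝ) ^ β ≤ M n := by
      have := (abs_le.1 (hM n)).1
      linarith
    calc (h n : ℝ) ≤ B * (n : ℝ) ^ γ := hh
      _ = 2 * B / C₄ * (n : ℝ) ^ (γ - β) * (C₄ / 2 * (n : ℝ) ^ β) := by
          rw [Real.rpow_sub hn0]
          field_simp
      _ ≤ _ := mul_le_mul_of_nonneg_left hM2 (by positivity)
  have hK : (1 - popularMass s (m n) (h n)) * (2 * K + 2) ≤ 4 := by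
    have hsq : 1 ≤ √(n : ℝ) := Real.one_le_sqrt.2 hn1
    have hKs : (K : ℝ) ≤ √(n : ℝ) := by
      refine Real.le_sqrt_of_sq_le (hK2.trans (div_le_self hn0.le hlog1))
    calc (1 - popularMass s (m n) (h n)) * (2 * K + 2) ≤ 1 / √(n : ℝ) * (4 * √(n : ℝ)) := by
          gcongr
          linarith
      _ = 4 := by field_simp
  have hAD : A ≤ D * (n : ℝ) ^ (γ - β) := by
    push_cast at hA
    have : D * (n : ℝ) ^ (γ - β) =
      2 * (2 * B / C₄ * (n : ℝ) ^ (γ - β)) + 10 * (n : ℝ) ^ (γ - β) := by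
      rw [hD]
      ring
    linarith
  calc w / D * ((n : ℝ) ^ (β - γ) / Real.log n) =
        w / (Real.log n * (D * (n : ℝ) ^ (γ - β))) := by
        rw [show β - γ = -(γ - β) by ring, Real.rpow_neg hn0.le]
        field_simp
    _ ≤ w / (Real.log n * A) := by gcongr

/-- When the caches are so large that contents are found well before the helper, the rate of
`exists_whp_le_capacity` is optimal. -/
theorem exists_whp_capacity_le (hC₁ : 0 < C₁) (hC₄ : 0 < C₄) (hW : 0 < W) (hΔ : 0 < Δ)
    (hβ0 : 0 ≤ β) (hβ : β ≤ γ) (hβγ : γ - 1 / 2 < β) (hm : ∀ᶠ n in atTop, 1 ≤ m n)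
    (hM : ∀ n : ℕ, |(M n : ℝ) - C₄ * (n : ℝ) ^ β| ≤ 1) (hM1 : ∀ᶠ n in atTop, 1 ≤ M n)
    (hhi : 0 < hi) (hRhi : ∀ᶠ n : ℕ in atTop, R n ≤ hi * √(Real.log n / n))
    (hocc : ∀ᶠ n : ℕ in atTop, √(Real.log n / n) ≤ C₁ * R n) (hlo : 0 < lo)
    (hh : ∀ᶠ n : ℕ in atTop, lo * (n : ℝ) ^ γ ≤ h n) (hMh : ∀ᶠ n in atTop, M n < h n)
    (hmass : ∀ᶠ n : ℕ in atTop, 1 - popularMass s (m n) (h n) ≤ 1 / √(n : ℝ)) :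
    ∃ c : ℝ, 0 < c ∧ WHP fun n => {Y | capacity W Δ C₁ (R n) s (m n) (M n) (h n) Y ≤
      c * ((n : ℝ) ^ (β - γ) / Real.log n)} := by
  have hK0 := eventually_rpow_le_gridSize hC₁ hhi hRhi hocc (sub_nonneg.2 hβ)
    (show γ - β < 1 / 2 by linarith) (show (0 : ℝ) < 64 by norm_num)
  set w := W / ((2 + Δ) * (1 / C₁)) ^ 2 with hw
  have hw0 : 0 < w := by positivity
  set b := min 1 (lo / (2 * (C₄ + 1))) with hb
  have hb0 : 0 < b := lt_min one_pos (by positivity)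
  refine ⟨w / (b / 8), by positivity, whp_far.mono ?_⟩
  filter_upwards [hK0, hm, hM1, hRhi, hocc, hh, hmass, eventually_log_pos,
    eventually_ge_atTop 4, hMh] with n hK0 hm hM1 hRhi hocc hh hmass hlog hn4 hMh Y hY
  have hn : 1 ≤ n := by omega
  have hn0 : (0 : ℝ) < n := by exact_mod_cast hn
  have hn1 : (1 : ℝ) ≤ n := by exact_mod_cast hn
  have hM0 : (0 : ℝ) < M n := by exact_mod_cast hM1
  have hR : 1 / C₁ * √(Real.log n / n) ≤ R n := by
    rw [one_div, inv_mul_le_iff₀ hC₁]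
    exact hocc
  refine (capacity_bounds hn hm hW hΔ hC₁ hlog (by positivity) hR hRhi).2.trans ?_
  set K := gridSize C₁ (R n)
  have hp1 : 1 ≤ (n : ℝ) ^ (γ - β) := Real.one_le_rpow hn1 (by linarith)
  have hq1 : 1 ≤ (h n - 1) / M n := Nat.div_pos (by omega) hM1
  have hqM : (h n - 1) / M n * M n < h n := (Nat.div_mul_le_self _ _).trans_lt (by omega)
  have hq2 : h n ≤ 2 * ((h n - 1) / M n) * M n := by
    have h1 : h n - 1 < (h n - 1) / M n * M n + M n := Nat.lt_div_mul_add hM1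
    have h2 : 1 * M n ≤ (h n - 1) / M n * M n := Nat.mul_le_mul_right _ hq1
    rw [mul_assoc]
    omega
  have hbq : b * (n : ℝ) ^ (γ - β) ≤ ((h n - 1) / M n : ℕ) := by
    have hMu : (M n : ℝ) ≤ (C₄ + 1) * (n : ℝ) ^ β := by
      have h1 := (abs_le.1 (hM n)).2
      have h2 : 1 ≤ (n : ℝ) ^ β := Real.one_le_rpow hn1 hβ0
      linarith
    have hq2' : (h n : ℝ) ≤ 2 * ((h n - 1) / M n : ℕ) * M n := by exact_mod_cast hq2
    refine le_of_mul_le_mul_right ?_ hM0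
    calc b * (n : ℝ) ^ (γ - β) * M n
        ≤ lo / (2 * (C₄ + 1)) * (n : ℝ) ^ (γ - β) * ((C₄ + 1) * (n : ℝ) ^ β) := by
          gcongr
          exact min_le_right _ _
      _ = lo * (n : ℝ) ^ γ / 2 := by
          rw [Real.rpow_sub hn0]
          field_simp
      _ ≤ _ := by linarith
  have hbF : ∀ i ∈ farTerminals Y, b * (n : ℝ) ^ (γ - β) ≤ hopsToHelper K (Y i) := by
    intro i hi
    have hi : 1 / 32 ≤ |(Y i).1 - 1 / 2| := by simpa [farTerminals] using hi
    refine le_trans ?_ (le_hopsToHelper K (Y i))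
    have h1 : (K : ℝ) * (1 / 32) ≤ K * |(Y i).1 - 1 / 2| := by gcongr
    have h2 : b * (n : ℝ) ^ (γ - β) ≤ 1 * (n : ℝ) ^ (γ - β) := by
      gcongr
      exact min_le_left _ _
    linarith
  have hA := le_avgHops (s := s) (m := m n) (K := K) hq1 hqM hY hn (by positivity) hbq hbF
  have hApos := avgHops_pos (s := s) (M := M n) (h := h n) (K := K) (Y := Y) hn hm
  set A := avgHops s (m n) (M n) (h n) K Y
  have hmass2 : 1 / 2 ≤ popularMass s (m n) (h n) := by
    have h2 : (2 : ℝ) ≤ √(n : ℝ) := by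
      refine Real.le_sqrt_of_sq_le ?_
      have : (4 : ℝ) ≤ n := by exact_mod_cast hn4
      linarith
    have := one_div_le_one_div_of_le two_pos h2
    linarith
  have hAb : b / 8 * (n : ℝ) ^ (γ - β) ≤ A := by
    refine le_trans ?_ hA
    have : 1 / 2 * (b * (n : ℝ) ^ (γ - β)) ≤
        popularMass s (m n) (h n) * (b * (n : ℝ) ^ (γ - β)) := by gcongr
    linarith
  calc w / (Real.log n * A) ≤ w / (Real.log n * (b / 8 * (n : ℝ) ^ (γ - β))) := by gcongr
    _ = w / (b / 8) * ((n : ℝ) ^ (β - γ) / Real.log n) := by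
        rw [show β - γ = -(γ - β) by ring, Real.rpow_neg hn0.le]
        field_simp

end Rates

theorem eventually_mul_rpow_le {α γ C : ℝ} (hγ : 0 ≤ γ) (hγα : γ < α) (hC : 0 < C) {m : ℕ → ℕ}
    (hm : ∀ n : ℕ, |(m n : ℝ) - C * (n : ℝ) ^ α| ≤ 1) (B : ℝ) :
    ∀ᶠ n : ℕ in atTop, B * (n : ℝ) ^ γ ≤ m n := by
  filter_upwards [(tendsto_natCast_rpow (sub_pos.2 hγα)).eventually_ge_atTop ((B + 1) / C),
    eventually_ge_atTop 1] with n h1 h2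
  have hn0 : (0 : ℝ) < n := by exact_mod_cast h2
  have h3 : 1 ≤ (n : ℝ) ^ γ := Real.one_le_rpow (by exact_mod_cast h2) hγ
  have h4 := (abs_le.1 (hm n)).1
  have h5 : (B + 1) * (n : ℝ) ^ γ ≤ C * (n : ℝ) ^ α := by
    rw [div_le_iff₀ hC, Real.rpow_sub hn0, div_mul_eq_mul_div, le_div_iff₀ (by positivity)] at h1
    linarith
  linarith

theorem exists_isTheta_rpow_and_lt {β γ C : ℝ} (hγ : 0 ≤ γ) (hβ : β ≤ γ) (hC : 0 < C) {M : ℕ → ℕ}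
    (hM : ∀ n : ℕ, |(M n : ℝ) - C * (n : ℝ) ^ β| ≤ 1) :
    ∃ h : ℕ → ℕ, (fun n => (h n : ℝ)) =Θ[atTop] (fun n : ℕ => (n : ℝ) ^ γ) ∧
      ∀ᶠ n in atTop, M n < h n := by
  refine ⟨fun n => ⌈(C + 2) * (n : ℝ) ^ γ⌉₊, ⟨?_, ?_⟩, ?_⟩
  · refine IsBigO.of_bound (C + 3) ?_
    filter_upwards [eventually_ge_atTop 1] with n hn
    have h3 : 1 ≤ (n : ℝ) ^ γ := Real.one_le_rpow (by exact_mod_cast hn) hγ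
    have h4 := Nat.ceil_lt_add_one (show 0 ≤ (C + 2) * (n : ℝ) ^ γ by positivity)
    rw [Real.norm_of_nonneg (by positivity), Real.norm_of_nonneg (by positivity)]
    linarith
  · refine IsBigO.of_bound 1 (Eventually.of_forall fun n => ?_)
    rw [Real.norm_of_nonneg (by positivity), Real.norm_of_nonneg (by positivity), one_mul]
    refine le_trans ?_ (Nat.le_ceil _)
    exact le_mul_of_one_le_left (by positivity) (by linarith)
  · filter_upwards [eventually_ge_atTop 1] with n hn
    have hn' : (1 : ℝ) ≤ n := by exact_mod_cast hn
    have h1 : 1 ≤ (n : ℝ) ^ γ := Real.one_le_rpow hn' hγ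
    have h2 : (n : ℝ) ^ β ≤ (n : ℝ) ^ γ := Real.rpow_le_rpow_of_exponent_le hn' hβ
    have h3 := (abs_le.1 (hM n)).2
    have h4 := Nat.le_ceil ((C + 2) * (n : ℝ) ^ γ)
    have h5 : C * (n : ℝ) ^ β ≤ C * (n : ℝ) ^ γ := by gcongr
    have h6 : (M n : ℝ) < ⌈(C + 2) * (n : ℝ) ^ γ⌉₊ := by linarith
    exact_mod_cast h6

end CodedCaching

theorem corollary2
    -- Zipf parameter, growth exponents, and constants of the model
    (s α β C₁ C₃ C₄ W Δ : ℝ) (hs : 1 < s) (hα : 1 / (2 * (s - 1)) < α)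
    (hC₁ : 0 < C₁) (hC₃ : 0 < C₃) (hC₄ : 0 < C₄) (hW : 0 < W) (hΔ : 0 < Δ)
    -- the cache exponent: caches are not larger, in order, than the set of popular contents
    (hβ0 : 0 ≤ β) (hβ : β ≤ (α + 1 / 2) / s)
    -- number of contents and cache size, rounded to integers
    (m M : ℕ → ℕ) (hm : ∀ n : ℕ, |(m n : ℝ) - C₃ * (n : ℝ) ^ α| ≤ 1)
    (hM : ∀ n : ℕ, |(M n : ℝ) - C₄ * (n : ℝ) ^ β| ≤ 1) (hM1 : ∀ᶠ n in atTop, 1 ≤ M n)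
    -- transmission range, large enough for all square-lets to be occupied
    (R : ℕ → ℝ) (hR : R =Θ[atTop] fun n : ℕ => √(Real.log n / n))
    (hocc : ∀ᶠ n : ℕ in atTop, √(Real.log n / n) ≤ C₁ * R n) :
    -- coding over the first `h n` contents, with `h n` of order `n ^ ((α + 1 / 2) / s)`
    (∃ h : ℕ → ℕ, (fun n => (h n : ℝ)) =Θ[atTop] (fun n : ℕ => (n : ℝ) ^ ((α + 1 / 2) / s)) ∧
      ∀ᶠ n in atTop, M n < h n) ∧
    (∀ h : ℕ → ℕ, (fun n => (h n : ℝ)) =Θ[atTop] (fun n : ℕ => (n : ℝ) ^ ((α + 1 / 2) / s)) →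
      (∀ᶠ n in atTop, M n < h n) →
      (∀ᶠ n : ℕ in atTop, h n ≤ m n ∧ 1 - 1 / √(n : ℝ) ≤ CodedCaching.popularMass s (m n) (h n)) ∧
      (∃ c : ℝ, 0 < c ∧ CodedCaching.WHP fun n =>
        {Y | CodedCaching.AllOccupied (CodedCaching.gridSize C₁ (R n)) Y ∧
          c * ((n : ℝ) ^ (β - (α + 1 / 2) / s) / Real.log n) ≤
            CodedCaching.capacity W Δ C₁ (R n) s (m n) (M n) (h n) Y}) ∧
      ((α + 1 / 2) / s - 1 / 2 < β →
        ∃ c c' : ℝ, 0 < c ∧ 0 < c' ∧ CodedCaching.WHP fun n =>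
          {Y | CodedCaching.AllOccupied (CodedCaching.gridSize C₁ (R n)) Y ∧
            c * ((n : ℝ) ^ (β - (α + 1 / 2) / s) / Real.log n) ≤
              CodedCaching.capacity W Δ C₁ (R n) s (m n) (M n) (h n) Y ∧
            CodedCaching.capacity W Δ C₁ (R n) s (m n) (M n) (h n) Y ≤
              c' * ((n : ℝ) ^ (β - (α + 1 / 2) / s) / Real.log n)})) ∧
    -- coding over the smallest set of contents of probability at least `1 - 1 / √n`
    (∃ c : ℝ, 0 < c ∧ CodedCaching.WHP fun n =>
      {Y | CodedCaching.AllOccupied (CodedCaching.gridSize C₁ (R n)) Y ∧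
        c * ((n : ℝ) ^ (β - (α + 1 / 2) / s) / Real.log n) ≤
          CodedCaching.capacity W Δ C₁ (R n) s (m n) (M n)
            (CodedCaching.popularCount s (m n) (1 / √(n : ℝ))) Y}) := by
  have hs0 : 0 < s := by linarith
  have hα0 : 0 < α := lt_trans (one_div_pos.2 (by linarith)) hα
  have hsα : 1 / 2 < (s - 1) * α := by
    rw [div_lt_iff₀ (by linarith)] at hα
    linarith
  set γ := (α + 1 / 2) / s with hγ
  have hγs : γ * s = α + 1 / 2 := div_mul_cancel₀ _ hs0.ne'
  have hγ0 : 0 < γ := by positivity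
  have hsγ : 1 / 2 < (s - 1) * γ := by
    rw [hγ, ← mul_div_assoc, lt_div_iff₀ hs0]
    linarith
  have hγα : γ < α := by
    rw [hγ, div_lt_iff₀ hs0]
    linarith
  have hmB := CodedCaching.eventually_mul_rpow_le hγ0.le hγα hC₃ hm
  have hm1 : ∀ᶠ n in atTop, 1 ≤ m n := by
    filter_upwards [hmB 1, eventually_ge_atTop 1] with n h1 h2
    have h3 : 1 ≤ (n : ℝ) ^ γ := Real.one_le_rpow (by exact_mod_cast h2) hγ0.le
    have h4 : (1 : ℝ) ≤ m n := by linarith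
    exact_mod_cast h4
  obtain ⟨hi, hhi, hRhi⟩ := hR.1.exists_pos
  have hRhi : ∀ᶠ n : ℕ in atTop, R n ≤ hi * √(Real.log n / n) := by
    filter_upwards [hRhi.bound] with n hn
    rw [Real.norm_of_nonneg (Real.sqrt_nonneg _)] at hn
    exact (le_abs_self _).trans hn
  refine ⟨CodedCaching.exists_isTheta_rpow_and_lt hγ0.le hβ hC₄ hM, fun h hh hMh => ?_, ?_⟩
  · obtain ⟨B, hB, hhB⟩ := hh.1.exists_pos
    obtain ⟨lo, hlo, hhlo⟩ := hh.2.exists_pos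
    have hhB : ∀ᶠ n : ℕ in atTop, (h n : ℝ) ≤ B * (n : ℝ) ^ γ := by
      filter_upwards [hhB.bound] with n hn
      rwa [Real.norm_of_nonneg (by positivity), Real.norm_of_nonneg (by positivity)] at hn
    have hhlo : ∀ᶠ n : ℕ in atTop, lo⁻¹ * (n : ℝ) ^ γ ≤ h n := by
      filter_upwards [hhlo.bound] with n hn
      rw [Real.norm_of_nonneg (by positivity), Real.norm_of_nonneg (by positivity)] at hn
      rwa [inv_mul_le_iff₀ hlo]
    have hmass := CodedCaching.eventually_one_sub_popularMass_le hγ0 hsγ hm1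
      (inv_pos.2 hlo) hhlo
    obtain ⟨c, hc, hlow⟩ := CodedCaching.exists_whp_le_capacity hC₁ hC₄ hW hΔ hβ hm1 hM hM1 hhi
      hRhi hocc hB hhB hmass
    refine ⟨?_, ⟨c, hc, hlow⟩, fun hβγ => ?_⟩
    · filter_upwards [hmB B, hhB, hmass] with n h1 h2 h3
      exact ⟨by exact_mod_cast h2.trans h1, by linarith⟩
    · obtain ⟨c', hc', hup⟩ := CodedCaching.exists_whp_capacity_le hC₁ hC₄ hW hΔ hβ0 hβ hβγ hm1
        hM hM1 hhi hRhi hocc (inv_pos.2 hlo) hhlo hMh hmass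
      exact ⟨c, c', hc, hc', (hlow.inter hup).mono
        (Eventually.of_forall fun n Y hY => ⟨hY.1.1, hY.1.2, hY.2⟩)⟩
  · have hmass := CodedCaching.eventually_one_sub_popularMass_le (h := fun n => ⌈(n : ℝ) ^ γ⌉₊)
      hγ0 hsγ hm1 zero_lt_one (Eventually.of_forall fun n => by
        rw [one_mul]
        exact Nat.le_ceil _)
    refine CodedCaching.exists_whp_le_capacity hC₁ hC₄ hW hΔ hβ hm1 hM hM1 hhi hRhi hocc
      (B := 2) two_pos ?_ ?_
    · filter_upwards [hmass, eventually_ge_atTop 1] with n h1 h2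
      have h3 : 1 ≤ (n : ℝ) ^ γ := Real.one_le_rpow (by exact_mod_cast h2) hγ0.le
      have h4 : CodedCaching.popularCount s (m n) (1 / √(n : ℝ)) ≤ ⌈(n : ℝ) ^ γ⌉₊ :=
        Nat.sInf_le (by
          rw [Set.mem_ofPred_eq]
          linarith)
      have h5 := Nat.ceil_lt_add_one (show 0 ≤ (n : ℝ) ^ γ by linarith)
      have h6 : (CodedCaching.popularCount s (m n) (1 / √(n : ℝ)) : ℝ) ≤ ⌈(n : ℝ) ^ γ⌉₊ := by
        exact_mod_cast h4
      linarith
    · filter_upwards [hmass] with n h1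
      have hmem : CodedCaching.popularCount s (m n) (1 / √(n : ℝ)) ∈
          {k : ℕ | 1 - 1 / √(n : ℝ) ≤ CodedCaching.popularMass s (m n) k} :=
        Nat.sInf_mem ⟨⌈(n : ℝ) ^ γ⌉₊, by
          rw [Set.mem_ofPred_eq]
          linarith⟩
      rw [Set.mem_ofPred_eq] at hmem
      linarith
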